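/- For $\alpha\in\mathbb C$ let $P_\alpha(z)=e^{2i\pi\alpha}z+z^2$, and let $P_\alpha^{\circ q}$ be its $q$-th iterate. Let $p\in\mathbb Z$ and $q\ge 1$ be coprime integers and put $\zeta=e^{2i\pi p/q}$. Let $R(p/q)$ be the largest real number $R$ such that, for every complex $\alpha\ne p/q$ with $|\alpha-p/q|<R$, the map $P_\alpha^{\circ q}$ has no multiple fixed point (that is, no point $z$ with $P_\alpha^{\circ q}(z)=z$ and $(P_\alpha^{\circ q})'(z)=1$), and let $r(p/q)=R(p/q)^{1/q}$. Then $r(p/q)>0$, and there is an analytic function $\chi:B(0,r(p/q))\to\mathbb C$, where $B(0,r)=\{\delta\in\mathbb C:|\delta|<r\}$, such that $\chi(0)=0$ and, for every $\delta\in B(0,r(p/q))\setminus\{0\}$: $\chi(\delta)\neq0$; the set $$\{\chi(\delta),\chi(\zeta\delta),\chi(\zeta^2\delta),\ldots,\chi(\zeta^{q-1}\delta)\}$$ is a cycle of (exact) period $q$ of $P_{p/q+\delta^q}$, so that these $q$ points are distinct; and $P_{p/q+\delta^q}$ permutes them in the listed cyclic order, i.e. $P_{p/q+\delta^q}(\chi(\delta))=\chi(\zeta\delta)$.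 -/

import Mathlib

/-- The quadratic polynomial `P_α(z) = e^{2iπα} z + z²` with complex parameter `α`. -/
noncomputable def quadP (α : ℂ) (z : ℂ) : ℂ :=
  Complex.exp (2 * Real.pi * Complex.I * α) * z + z ^ 2

/-- `z` is a multiple fixed point of `f`: it is a zero of `f(z) - z` at which the derivative of
`f(z) - z` vanishes as well (only used for polynomial maps `f`). -/
def IsMultipleFixedPt (f : ℂ → ℂ) (z : ℂ) : Prop :=
  Function.IsFixedPt f z ∧ deriv f z = 1

/-- The reals `R` such that `P_α^{∘q}` has no multiple fixed point for any
`α ∈ B(p/q, R) \ {p/q}`. -/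
def noMultipleRadii (p : ℤ) (q : ℕ) : Set ℝ :=
  {R | ∀ α ∈ Metric.ball ((p : ℂ) / (q : ℂ)) R \ {(p : ℂ) / (q : ℂ)},
    ∀ z : ℂ, ¬ IsMultipleFixedPt (quadP α)^[q] z}

/-- `R(p/q)`, the largest element of `noMultipleRadii p q`. -/
noncomputable def bigR (p : ℤ) (q : ℕ) : ℝ :=
  sSup (noMultipleRadii p q)

/-- `r(p/q) = R(p/q)^{1/q}`. -/
noncomputable def smallR (p : ℤ) (q : ℕ) : ℝ :=
  bigR p q ^ (1 / (q : ℝ))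

/-- The set `S` is a cycle of period `n` of `f`: it is the forward orbit
`{z, f z, …, f^{n-1} z}` of a periodic point `z` whose least period is `n ≥ 1`. -/
def IsCycle (f : ℂ → ℂ) (n : ℕ) (S : Set ℂ) : Prop :=
  0 < n ∧ ∃ z : ℂ, Function.minimalPeriod f z = n ∧ S = {w | ∃ k < n, w = f^[k] z}

theorem le_one_of_mem_noMultipleRadii {p : ℤ} {q : ℕ} (hq : 0 < q) {R : ℝ}
    (hR : R ∈ noMultipleRadii p q) : R ≤ 1 := by
  by_contra! h
  have hq' : (q : ℂ) ≠ 0 := by exact_mod_cast hq.ne'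
  refine hR ((p : ℂ) / q + 1) ⟨by simpa using h, by simp⟩ 0 ?_
  have h0 : quadP ((p : ℂ) / q + 1) 0 = 0 := by simp [quadP]
  have hd : HasDerivAt (quadP ((p : ℂ) / q + 1))
      (Complex.exp (2 * Real.pi * Complex.I * ((p : ℂ) / q + 1))) 0 := by
    have h1 := ((hasDerivAt_id (0 : ℂ)).const_mul
      (Complex.exp (2 * Real.pi * Complex.I * ((p : ℂ) / q + 1)))).fun_add (hasDerivAt_pow 2 (0 : ℂ))
    simp only [id] at h1
    exact h1.congr_deriv (by simp)
  refine ⟨Function.iterate_fixed h0 q, ?_⟩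
  rw [(HasDerivAt.iterate 0 hd h0 q).deriv, ← Complex.exp_nat_mul, Complex.exp_eq_one_iff]
  refine ⟨p + q, ?_⟩
  push_cast
  field_simp

/-- The number `bigR p q` is indeed the largest element of `noMultipleRadii p q`. -/
theorem isGreatest_bigR {p : ℤ} {q : ℕ} (hq : 0 < q) :
    IsGreatest (noMultipleRadii p q) (bigR p q) := by
  have hb : BddAbove (noMultipleRadii p q) := ⟨1, fun R hR => le_one_of_mem_noMultipleRadii hq hR⟩
  have hne : (noMultipleRadii p q).Nonempty := ⟨0, fun α hα => by simp at hα⟩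
  refine ⟨fun α hα z => ?_, fun R hR => le_csSup hb hR⟩
  obtain ⟨R, hR, hlt⟩ := exists_lt_of_lt_csSup hne (Metric.mem_ball.1 hα.1)
  exact hR α ⟨Metric.mem_ball.2 hlt, hα.2⟩ z

/-!
Write `f_c(z) = c z + z²` and `ζ = e^{2πip/q}`, a primitive `q`-th root of unity.

*Positivity of the radius.* A multiple fixed point of `f_c^q` forces a resultant, polynomial in
`c`, to vanish (`fixResultant_eval_eq_zero`). At `c = 0` the fixed points are the roots of
`z ^ 2 ^ q - z`, all simple, so the resultant is not the zero polynomial and its zeros are isolated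
(`bigR_pos`).

*Exactly `q` petals.* Write `f_ζ^q(z) = z + a z ^ (m + 1) + …` with `a ≠ 0`. Since `f_ζ` commutes
with its iterate, `ζ ^ m = 1`, so `q ∣ m` (`pow_petal_number_eq_one`). Conversely, in the coordinate
`z = κ Z ^ (-1 / m)`, where `κ ^ m = -1 / (m a)`, the iterate becomes a map `G(Z) = Z + 1 + o(1)`
of a right half plane (`exists_petal_conj`). If the orbit of the critical value avoided such a
petal, the petal parametrisation would lift holomorphically through all iterates of `f_ζ`; the
lifts are uniformly bounded, they send `G^n(Z)` back to the petal point of `Z`, and they live on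
discs of radius of order `n` around `G^n(Z)`, while two orbits of `G` stay at distance `o(n)`. The
Schwarz lemma then makes the parametrisation constant, which is absurd
(`exists_iterate_critValue_mem_petal`). Hence the orbit of the critical value converges along every
attracting direction `κ`, so all `κ` differ by powers of `ζ` and `m ∣ q` (`petal_number_dvd`).

*Local branch.* Since `m = q`, the fixed point equation for the parameter `p / q + δ ^ q`, divided
by `δ ^ (q + 1) y` after the substitution `z = δ y`, reads `2πi q + a y ^ q = 0` at `δ = 0`. A root
`y₀ ≠ 0` is simple, and the implicit function theorem gives a branch `χ(δ) = y₀ δ + …`; local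
uniqueness yields `f(χ(δ)) = χ(ζ δ)` (`exists_local_branch`).

*Continuation.* For `0 < |δ| < r(p/q)` all fixed points of the iterate are simple, so that they
form a covering of the punctured disc, and the branch continues along radii
(`exists_continuation_of_branch`). Branches of fixed points that meet over the punctured disc
coincide (`branch_unique`); as `χ`, `0` and `χ(ζ^k ·)` have different derivatives at `0`, the
points of the cycle are distinct and nonzero.
-/

open Polynomial Filter Topology
open scoped ContDiff unitInterval

/-! ### Iterates of quadratic polynomials as polynomials in the multiplier -/

/-- The quadratic polynomial `z ↦ c z + z²`, parametrised by its multiplier `c` at the fixed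
point `0`. -/
def quadMap (c z : ℂ) : ℂ := c * z + z ^ 2

theorem quadP_eq_quadMap (α : ℂ) :
    quadP α = quadMap (Complex.exp (2 * Real.pi * Complex.I * α)) := rfl

/-- The `n`-th iterate of `z ↦ c z + z²` as a polynomial in `z` (the outer variable) over the
polynomial ring in `c` (the inner variable). -/
noncomputable def iterPoly : ℕ → ℂ[X][X]
  | 0 => X
  | n + 1 => iterPoly n * (iterPoly n + C X)

theorem eval_map_iterPoly (n : ℕ) (c z : ℂ) :
    ((iterPoly n).map (evalRingHom c)).eval z = (quadMap c)^[n] z := by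
  induction n with
  | zero => simp [iterPoly]
  | succ n ih =>
    rw [Function.iterate_succ_apply', ← ih, iterPoly]
    simp [quadMap]
    ring

theorem iterPoly_monic_natDegree (n : ℕ) :
    (iterPoly n).Monic ∧ (iterPoly n).natDegree = 2 ^ n := by
  induction n with
  | zero => simp [iterPoly, monic_X]
  | succ n ih =>
    have hlt : (C (X : ℂ[X])).degree < (iterPoly n).degree := by
      refine lt_of_le_of_lt degree_C_le ?_
      rw [degree_eq_natDegree ih.1.ne_zero, ih.2]
      exact_mod_cast Nat.pos_of_ne_zero (by positivity)
    have hm : (iterPoly n + C X).Monic := ih.1.add_of_left hlt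
    refine ⟨ih.1.mul hm, ?_⟩
    rw [iterPoly, ih.1.natDegree_mul hm, natDegree_add_eq_left_of_degree_lt hlt, ih.2]
    ring

/-- The polynomial in `z` whose roots are the fixed points of the `n`-th iterate. -/
noncomputable def fixPoly (n : ℕ) : ℂ[X][X] := iterPoly n - X

theorem eval_map_fixPoly (n : ℕ) (c z : ℂ) :
    ((fixPoly n).map (evalRingHom c)).eval z = (quadMap c)^[n] z - z := by
  simp [fixPoly, ← eval_map_iterPoly]

theorem fixPoly_monic_natDegree {n : ℕ} (hn : 0 < n) :
    (fixPoly n).Monic ∧ (fixPoly n).natDegree = 2 ^ n := by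
  obtain ⟨hm, hd⟩ := iterPoly_monic_natDegree n
  have hlt : (X : ℂ[X][X]).degree < (iterPoly n).degree := by
    rw [degree_X, degree_eq_natDegree hm.ne_zero, hd]
    exact_mod_cast Nat.one_lt_two_pow hn.ne'
  exact ⟨hm.sub_of_left hlt, by rw [fixPoly, natDegree_sub_eq_left_of_natDegree_lt
    (natDegree_lt_natDegree (by simp) hlt), hd]⟩

theorem deriv_iterate_quadMap (n : ℕ) (c z : ℂ) :
    deriv (quadMap c)^[n] z = ((iterPoly n).map (evalRingHom c)).derivative.eval z := by
  rw [← Polynomial.deriv]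
  congr 1
  ext w
  exact (eval_map_iterPoly n c w).symm

theorem eval_derivative_map_fixPoly (n : ℕ) (c z : ℂ) :
    ((fixPoly n).map (evalRingHom c)).derivative.eval z = deriv (quadMap c)^[n] z - 1 := by
  simp [fixPoly, deriv_iterate_quadMap]

theorem differentiable_iterate_quadMap (n : ℕ) (c : ℂ) : Differentiable ℂ (quadMap c)^[n] := by
  have : (quadMap c)^[n] = fun w => ((iterPoly n).map (evalRingHom c)).eval w :=
    funext fun w => (eval_map_iterPoly n c w).symm
  rw [this]
  exact Polynomial.differentiable _

/-! ### Multiple fixed points and the resultant -/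

/-- The polynomial `X ^ N - X` is separable, by an explicit Bézout identity in
`Y = X ^ (N - 1)`. -/
theorem isCoprime_X_pow_sub_X {N : ℕ} (hN : 2 ≤ N) :
    IsCoprime (X ^ N - X : ℂ[X]) (derivative (X ^ N - X)) := by
  obtain ⟨k, rfl⟩ := Nat.exists_eq_add_of_le hN
  have hk : ((1 : ℂ) - (2 + k)) ≠ 0 := by
    have : ((k + 1 : ℕ) : ℂ) ≠ 0 := Nat.cast_ne_zero.2 (Nat.succ_ne_zero k)
    intro h
    apply this
    push_cast
    linear_combination -h
  have hC : (C ((1 : ℂ) - (2 + k))⁻¹ : ℂ[X]) * (1 - (2 + (k : ℂ[X]))) = 1 := by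
    have : (1 - (2 + (k : ℂ[X]))) = C ((1 : ℂ) - (2 + k)) := by
      simp [map_ofNat C 2]
    rw [this, ← C_mul, inv_mul_cancel₀ hk, C_1]
  refine ⟨C ((1 : ℂ) - (2 + k))⁻¹ * ((2 + (k : ℂ[X])) ^ 2 * X ^ k),
    -C ((1 : ℂ) - (2 + k))⁻¹ * ((2 + (k : ℂ[X])) * X ^ (k + 1) + (1 - (2 + (k : ℂ[X])))), ?_⟩
  have hd : derivative (X ^ (2 + k) - X : ℂ[X]) = (2 + (k : ℂ[X])) * X ^ (k + 1) - 1 := by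
    rw [derivative_sub, derivative_X_pow, derivative_X, show 2 + k - 1 = k + 1 by omega]
    simp [map_ofNat C 2]
  rw [hd]
  linear_combination hC

/-- The resultant in `z` of the fixed point polynomial and its derivative. -/
noncomputable def fixResultant (n : ℕ) : ℂ[X] :=
  resultant (fixPoly n) (derivative (fixPoly n)) (2 ^ n) (2 ^ n - 1)

theorem fixResultant_ne_zero {n : ℕ} (hn : 0 < n) : fixResultant n ≠ 0 := by
  intro h0
  have hN : 2 ≤ 2 ^ n := by
    calc 2 = 2 ^ 1 := rfl
      _ ≤ 2 ^ n := Nat.pow_le_pow_right (by norm_num) hn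
  have h1 : (fixPoly n).map (evalRingHom (0 : ℂ)) = X ^ (2 ^ n) - X := by
    refine Polynomial.funext fun z => ?_
    rw [eval_map_fixPoly]
    have : (quadMap 0)^[n] z = z ^ 2 ^ n := by
      have h2 : quadMap 0 = fun z : ℂ => z ^ 2 := by ext z; simp [quadMap]
      rw [h2]
      exact congrFun (pow_iterate 2 n) z
    simp [this]
  have h2 : (fixResultant n).eval 0 = resultant (X ^ (2 ^ n) - X : ℂ[X])
      (derivative (X ^ (2 ^ n) - X)) (2 ^ n) (2 ^ n - 1) := by
    rw [← h1, derivative_map, resultant_map_map]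
    rfl
  have hdeg : (X ^ (2 ^ n) - X : ℂ[X]).natDegree = 2 ^ n := by
    rw [natDegree_sub_eq_left_of_natDegree_lt] <;> simp
    omega
  have hdeg' : (derivative (X ^ (2 ^ n) - X : ℂ[X])).natDegree = 2 ^ n - 1 := by
    rw [natDegree_derivative, hdeg]
  have h3 := resultant_ne_zero _ _ (isCoprime_X_pow_sub_X hN)
  rw [hdeg, hdeg', ← h2, h0] at h3
  simp at h3

theorem fixResultant_eval_eq_zero {n : ℕ} (hn : 0 < n) {c z : ℂ}
    (hz : IsMultipleFixedPt (quadMap c)^[n] z) : (fixResultant n).eval c = 0 := by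
  obtain ⟨u, v, -, -, h⟩ := exists_mul_add_mul_eq_C_resultant (fixPoly n) (derivative (fixPoly n))
    (m := 2 ^ n) (n := 2 ^ n - 1) (fixPoly_monic_natDegree hn).2.le
    ((natDegree_derivative_le _).trans (by rw [(fixPoly_monic_natDegree hn).2]))
    (Or.inl (by positivity))
  have h' := congrArg (fun P : ℂ[X][X] => (P.map (evalRingHom c)).eval z) h
  simp only [Polynomial.map_add, Polynomial.map_mul, eval_add, eval_mul, ← derivative_map,
    eval_map_fixPoly, eval_derivative_map_fixPoly, hz.1.eq, hz.2, map_C, eval_C] at h'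
  simpa [fixResultant] using h'.symm

theorem bigR_pos {p : ℤ} {q : ℕ} (hq : 0 < q) : 0 < bigR p q := by
  set α₀ : ℂ := (p : ℂ) / q
  set e : ℂ → ℂ := fun α => Complex.exp (2 * Real.pi * Complex.I * α)
  have he : HasDerivAt e (Complex.exp (2 * Real.pi * Complex.I * α₀) *
      (2 * Real.pi * Complex.I * 1)) α₀ :=
    ((hasDerivAt_id α₀).const_mul (2 * Real.pi * Complex.I)).cexp
  have he' := he.tendsto_nhdsNE (by simp [Complex.exp_ne_zero, Real.pi_ne_zero])
  have hfin : ∀ᶠ c in 𝓝[≠] (e α₀), (fixResultant q).eval c ≠ 0 := by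
    rcases (AnalyticAt.aeval_polynomial (analyticAt_id (𝕜 := ℂ) (z := e α₀))
      (fixResultant q)).eventually_eq_zero_or_eventually_ne_zero with h | h
    · refine absurd ?_ (fixResultant_ne_zero hq)
      refine Polynomial.eq_zero_of_infinite_isRoot _ ?_
      exact (infinite_of_mem_nhds (e α₀) h).mono fun c hc => by simpa [IsRoot] using hc
    · simpa using h
  obtain ⟨R, hR, hsub⟩ := Metric.mem_nhdsWithin_iff.1 (he'.eventually hfin)
  refine lt_of_lt_of_le hR ((isGreatest_bigR hq).2 fun α hα z hz => ?_)
  exact hsub ⟨hα.1, hα.2⟩ (fixResultant_eval_eq_zero hq (by rwa [quadP_eq_quadMap] at hz))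

/-! ### Dependence of the iterates on the multiplier -/

/-- Dependence of the iterates on the multiplier: `g_c(z) - g_ζ(z)` is divisible by `z (c - ζ)`
with an analytic quotient, whose value at `(ζ, 0)` is the derivative of `c ^ n` at `ζ`. -/
theorem exists_iterate_quadMap_sub_eq (ζ : ℂ) (n : ℕ) :
    ∃ A : ℂ × ℂ → ℂ, ContDiff ℂ ω A ∧ A (ζ, 0) = n * ζ ^ (n - 1) ∧
      ∀ c z, (quadMap c)^[n] z - (quadMap ζ)^[n] z = z * (c - ζ) * A (c, z) := by
  suffices ∃ A Φ : ℂ × ℂ → ℂ, ContDiff ℂ ω A ∧ ContDiff ℂ ω Φ ∧ A (ζ, 0) = n * ζ ^ (n - 1) ∧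
      (∀ c, Φ (c, 0) = c ^ n) ∧ (∀ c z, (quadMap c)^[n] z = z * Φ (c, z)) ∧
      ∀ c z, (quadMap c)^[n] z - (quadMap ζ)^[n] z = z * (c - ζ) * A (c, z) by
    obtain ⟨A, -, h1, -, h2, -, -, h3⟩ := this
    exact ⟨A, h1, h2, h3⟩
  induction n with
  | zero => exact ⟨0, 1, contDiff_const, contDiff_const, by simp, by simp, by simp, by simp⟩
  | succ n ih =>
    obtain ⟨A, Φ, hA, hΦ, hA0, hΦ0, h1, h2⟩ := ih
    refine ⟨fun x => Φ x + (ζ + x.2 * Φ x + x.2 * Φ (ζ, x.2)) * A x,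
      fun x => Φ x * (x.1 + x.2 * Φ x), ?_, ?_, ?_, ?_, ?_, ?_⟩
    · have : ContDiff ℂ ω fun x : ℂ × ℂ => Φ (ζ, x.2) :=
        hΦ.comp (contDiff_const.prodMk contDiff_snd)
      fun_prop
    · fun_prop
    · simp only [hΦ0, hA0]
      rcases n with _ | n
      · simp
      · simp; ring
    · intro c; simp [hΦ0, pow_succ]
    · intro c z
      rw [Function.iterate_succ_apply', h1, quadMap]
      ring
    · intro c z
      have h3 := h2 c z
      rw [Function.iterate_succ_apply', Function.iterate_succ_apply', quadMap, quadMap]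
      rw [h1, h1] at h3 ⊢
      linear_combination (ζ + z * Φ (c, z) + z * Φ (ζ, z)) * h3

/-! ### Attracting petals -/

/-- The branch `κ Z ^ (-1 / m)` of the coordinate change which, on a right half plane, parametrises
an attracting petal in the direction `κ`; the principal logarithm is used. -/
noncomputable def petal (m : ℕ) (κ Z : ℂ) : ℂ := κ * Complex.exp (-Complex.log Z / m)

theorem petal_pow {m : ℕ} (hm : 0 < m) (κ : ℂ) {Z : ℂ} (hZ : Z ≠ 0) :
    petal m κ Z ^ m = κ ^ m / Z := by
  have hm' : (m : ℂ) ≠ 0 := Nat.cast_ne_zero.2 hm.ne'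
  rw [petal, mul_pow, ← Complex.exp_nat_mul, mul_div_cancel₀ _ hm', Complex.exp_neg,
    Complex.exp_log hZ, div_eq_mul_inv]

theorem tendsto_petal {m : ℕ} (hm : 0 < m) (κ : ℂ) :
    Tendsto (petal m κ) (Bornology.cobounded ℂ) (𝓝 0) := by
  have hm' : (0 : ℝ) < m := Nat.cast_pos.2 hm
  rw [tendsto_zero_iff_norm_tendsto_zero]
  have h1 : Tendsto (fun Z : ℂ => ‖κ‖ * Real.exp (-(Real.log ‖Z‖ / m))) (Bornology.cobounded ℂ)
      (𝓝 (‖κ‖ * 0)) := by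
    refine Tendsto.const_mul _ (Real.tendsto_exp_neg_atTop_nhds_zero.comp ?_)
    exact (Real.tendsto_log_atTop.comp tendsto_norm_cobounded_atTop).atTop_div_const hm'
  rw [mul_zero] at h1
  refine h1.congr fun Z => ?_
  have : (-Complex.log Z / (m : ℂ)).re = -(Real.log ‖Z‖ / m) := by
    rw [← Complex.ofReal_natCast, Complex.div_ofReal_re, Complex.neg_re, Complex.log_re, neg_div]
  rw [petal, norm_mul, Complex.norm_exp, this]

theorem differentiableAt_petal (m : ℕ) (κ : ℂ) {Z : ℂ} (hZ : Z ∈ Complex.slitPlane) :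
    DifferentiableAt ℂ (petal m κ) Z :=
  (((Complex.differentiableAt_log hZ).neg.div_const _).cexp).const_mul _

/-- In the petal coordinate a germ `z + z ^ (m + 1) B(z)` becomes a perturbation of the unit
translation, with an error that tends to `0` at infinity. -/
theorem exists_petal_conj {m : ℕ} (hm : 0 < m) {κ : ℂ} {B : ℂ → ℂ}
    (hB : Continuous B) (hκB : -(m * κ ^ m * B 0) = 1) :
    ∃ (R : ℝ) (G : ℂ → ℂ), 0 < R ∧
      Tendsto (fun Z => G Z - Z - 1) (Bornology.cobounded ℂ) (𝓝 0) ∧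
      ∀ Z : ℂ, R < Z.re → petal m κ (G Z) = petal m κ Z + petal m κ Z ^ (m + 1) * B (petal m κ Z) ∧
        ‖G Z - Z - 1‖ ≤ 1 / 4 ∧ ContinuousAt G Z ∧ ‖petal m κ Z‖ ≤ 1 := by
  have hm' : (m : ℂ) ≠ 0 := Nat.cast_ne_zero.2 hm.ne'
  set τ := petal m κ
  set ε : ℂ → ℂ := fun Z => τ Z ^ m * B (τ Z)
  set h : ℂ → ℂ := fun x => Complex.exp (-(m * Complex.log (1 + x)))
  set G : ℂ → ℂ := fun Z => Complex.exp (Complex.log Z - m * Complex.log (1 + ε Z))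
  have hτ : Tendsto τ (Bornology.cobounded ℂ) (𝓝 0) := tendsto_petal hm κ
  have hBτ : Tendsto (fun Z => B (τ Z)) (Bornology.cobounded ℂ) (𝓝 (B 0)) :=
    (hB.tendsto 0).comp hτ
  have hε : Tendsto ε (Bornology.cobounded ℂ) (𝓝 0) := by
    simpa [hm.ne'] using (hτ.pow m).mul hBτ
  have hlog : Tendsto (fun Z => m * Complex.log (1 + ε Z)) (Bornology.cobounded ℂ) (𝓝 0) := by
    have h1 : Tendsto (fun x : ℂ => m * Complex.log (1 + x)) (𝓝 0) (𝓝 (m * Complex.log (1 + 0))) :=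
      ((continuousAt_const.add continuousAt_id).clog (by simp)).const_mul _ |>.tendsto
    simp only [add_zero, Complex.log_one, mul_zero] at h1
    exact h1.comp hε
  have hne : ∀ᶠ Z : ℂ in Bornology.cobounded ℂ, Z ≠ 0 := Bornology.eventually_ne_cobounded 0
  have hh : HasDerivAt h (-m) 0 := by
    have h1 : HasDerivAt (fun x : ℂ => Complex.log (1 + x)) (1 / (1 + 0)) 0 :=
      ((hasDerivAt_id (0 : ℂ)).const_add 1).clog (by simp)
    have h2 := (h1.const_mul (m : ℂ)).neg.cexp
    simpa using h2
  have hE : Tendsto (fun Z => G Z - Z - 1) (Bornology.cobounded ℂ) (𝓝 0) := by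
    have h1 : Tendsto (fun Z => dslope h 0 (ε Z)) (Bornology.cobounded ℂ) (𝓝 (-m)) := by
      have : ContinuousAt (dslope h 0) 0 := continuousAt_dslope_same.2 hh.differentiableAt
      have h2 := this.tendsto
      rw [dslope_same, hh.deriv] at h2
      exact h2.comp hε
    have h2 := ((hBτ.const_mul (κ ^ m)).mul h1).sub_const 1
    have h3 : κ ^ m * B 0 * -↑m - 1 = 0 := by linear_combination hκB
    rw [h3] at h2
    refine h2.congr' ?_
    filter_upwards [hne] with Z hZ
    have h4 : G Z = Z * h (ε Z) := by
      simp only [G, h, sub_eq_add_neg, Complex.exp_add, Complex.exp_log hZ]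
    have h5 : ε Z * dslope h 0 (ε Z) = h (ε Z) - 1 := by
      have := sub_smul_dslope h 0 (ε Z)
      simpa [h] using this
    have h6 : Z * ε Z = κ ^ m * B (τ Z) := by
      simp only [ε, τ, petal_pow hm κ hZ]
      field_simp
    rw [h4]
    linear_combination Z * h5 - dslope h 0 (ε Z) * h6
  have hev : ∀ᶠ Z : ℂ in Bornology.cobounded ℂ, ‖G Z - Z - 1‖ < 1 / 4 ∧ ‖τ Z‖ < 1 ∧
      ‖ε Z‖ < 1 ∧ ‖m * Complex.log (1 + ε Z)‖ < 1 := by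
    refine ((tendsto_zero_iff_norm_tendsto_zero.1 hE).eventually_lt_const (by norm_num)).and
      (((tendsto_zero_iff_norm_tendsto_zero.1 hτ).eventually_lt_const (by norm_num)).and
      (((tendsto_zero_iff_norm_tendsto_zero.1 hε).eventually_lt_const (by norm_num)).and
      ((tendsto_zero_iff_norm_tendsto_zero.1 hlog).eventually_lt_const (by norm_num))))
  obtain ⟨R, hR⟩ : ∃ R : ℝ, ∀ Z : ℂ, R < ‖Z‖ → ‖G Z - Z - 1‖ < 1 / 4 ∧ ‖τ Z‖ < 1 ∧
      ‖ε Z‖ < 1 ∧ ‖m * Complex.log (1 + ε Z)‖ < 1 := by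
    rw [← comap_norm_atTop, (atTop_basis_Ioi.comap _).eventually_iff] at hev
    obtain ⟨R, -, hR⟩ := hev
    exact ⟨R, fun Z hZ => hR hZ⟩
  refine ⟨max R 1, G, by positivity, hE, fun Z hZ => ?_⟩
  have hZ0 : 0 < Z.re := lt_trans (by positivity) hZ
  obtain ⟨h1, h2, h3, h4⟩ := hR Z (lt_of_le_of_lt (le_max_left _ _)
    (hZ.trans_le (Complex.re_le_norm Z)))
  have hslit : 1 + ε Z ∈ Complex.slitPlane := Complex.mem_slitPlane_of_norm_lt_one h3
  have hZs : Z ∈ Complex.slitPlane := Or.inl hZ0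
  refine ⟨?_, h1.le, ?_, h2.le⟩
  · have harg : |Z.arg| < Real.pi / 2 := Complex.abs_arg_lt_pi_div_two_iff.2 (Or.inl hZ0)
    have him : |(m * Complex.log (1 + ε Z)).im| < Real.pi / 2 :=
      ((Complex.abs_im_le_norm _).trans_lt h4).trans (by linarith [Real.pi_gt_three])
    rw [abs_lt] at harg him
    have hlogG : Complex.log (G Z) = Complex.log Z - m * Complex.log (1 + ε Z) := by
      apply Complex.log_exp <;> rw [Complex.sub_im, Complex.log_im] <;> linarith
    have h5 : τ (G Z) = τ Z * (1 + ε Z) := by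
      simp only [τ, petal, hlogG]
      have : -(Complex.log Z - m * Complex.log (1 + ε Z)) / m =
          -Complex.log Z / m + Complex.log (1 + ε Z) := by field_simp; ring
      rw [this, Complex.exp_add, Complex.exp_log (Complex.slitPlane_ne_zero hslit)]
      ring
    rw [h5]
    ring
  · have hτc : ContinuousAt τ Z := (differentiableAt_petal m κ hZs).continuousAt
    have hεc : ContinuousAt ε Z := (hτc.pow m).mul (hB.continuousAt.comp hτc)
    exact ((continuousAt_id.clog hZs).sub
      (((continuousAt_const.add hεc).clog hslit).const_mul _)).cexp

/-- Iterates of a perturbed unit translation on a right half plane: they stay in the half plane and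
move right with positive speed, and `G^n(Z) ~ n`. -/
theorem iterate_perturbed_translation {R : ℝ} {G : ℂ → ℂ}
    (hE : Tendsto (fun Z => G Z - Z - 1) (Bornology.cobounded ℂ) (𝓝 0))
    (hG : ∀ Z : ℂ, R < Z.re → ‖G Z - Z - 1‖ ≤ 1 / 4) {Z : ℂ} (hZ : R < Z.re) :
    (∀ n : ℕ, Z.re + 3 / 4 * n ≤ (G^[n] Z).re) ∧
      Tendsto (fun n : ℕ => G^[n] Z / n) atTop (𝓝 1) := by
  have hre : ∀ n : ℕ, Z.re + 3 / 4 * n ≤ (G^[n] Z).re := by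
    intro n
    induction n with
    | zero => simp
    | succ n ih =>
      rw [Function.iterate_succ_apply']
      have h1 := hG (G^[n] Z) (hZ.trans_le (le_trans (by simp) ih))
      have h2 := (abs_le.1 ((Complex.abs_re_le_norm _).trans h1)).1
      simp only [Complex.sub_re, Complex.one_re] at h2
      push_cast
      linarith
  refine ⟨hre, ?_⟩
  have hcob : Tendsto (fun n : ℕ => G^[n] Z) atTop (Bornology.cobounded ℂ) := by
    rw [← tendsto_norm_atTop_iff_cobounded]
    refine tendsto_atTop_mono (fun n => (hre n).trans (Complex.re_le_norm _)) ?_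
    exact tendsto_atTop_add_const_left _ _
      (tendsto_natCast_atTop_atTop.const_mul_atTop (by norm_num))
  have h1 : Tendsto (fun n : ℕ => G^[n + 1] Z - G^[n] Z) atTop (𝓝 1) := by
    have := (hE.comp hcob).add_const 1
    simp only [zero_add] at this
    refine this.congr fun n => ?_
    simp [Function.iterate_succ_apply']
  have h2 := h1.cesaro_smul
  simp only [Finset.sum_range_sub (fun n => G^[n] Z), Function.iterate_zero, id] at h2
  have h3 : Tendsto (fun n : ℕ => Z / n) atTop (𝓝 0) := tendsto_const_div_atTop_nhds_zero_nat Z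
  have h4 := h2.add h3
  simp only [add_zero] at h4
  refine h4.congr fun n => ?_
  rw [Complex.real_smul]
  push_cast
  ring

/-- The radial rate at which orbits in an attracting petal converge to the parabolic point: the
limit of the rescaled orbit recovers the direction of the petal. -/
theorem tendsto_rescaled_petal {m : ℕ} {κ : ℂ} {u : ℕ → ℂ}
    (hu : Tendsto (fun n : ℕ => u n / n) atTop (𝓝 1)) :
    Tendsto (fun n : ℕ => Complex.exp (Complex.log n / m) * petal m κ (u n)) atTop (𝓝 κ) := by
  have h1 : Tendsto (fun n : ℕ => κ * Complex.exp (-Complex.log (u n / n) / m)) atTop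
      (𝓝 (κ * Complex.exp (-Complex.log 1 / m))) :=
    (((hu.clog (by simp)).neg.div_const _).cexp).const_mul _
  simp only [Complex.log_one, neg_zero, zero_div, Complex.exp_zero, mul_one] at h1
  refine h1.congr' ?_
  filter_upwards [eventually_gt_atTop 0, hu.eventually_ne one_ne_zero] with n hn hne
  have hn' : (0 : ℝ) < n := Nat.cast_pos.2 hn
  have hn0 : (n : ℂ) ≠ 0 := Nat.cast_ne_zero.2 hn.ne'
  have h2 : Complex.log (u n) = Complex.log n + Complex.log (u n / n) := by
    have h3 := Complex.log_ofReal_mul hn' hne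
    rw [Complex.ofReal_natCast, mul_div_cancel₀ _ hn0] at h3
    rw [h3, Complex.ofReal_log hn'.le, Complex.ofReal_natCast]
  rw [petal, h2, mul_left_comm, ← Complex.exp_add]
  congr 2
  ring

/-! ### Lifting through quadratic polynomials -/

/-- A continuous square root of a nonvanishing holomorphic function is holomorphic. -/
theorem differentiableOn_of_sq_eq {U : Set ℂ} (hU : IsOpen U) {s φ : ℂ → ℂ}
    (hs : ContinuousOn s U) (hφ : DifferentiableOn ℂ φ U) (h : ∀ z, s z ^ 2 = φ z)
    (h0 : ∀ z ∈ U, φ z ≠ 0) : DifferentiableOn ℂ s U := by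
  intro z hz
  have hsz : s z ≠ 0 := fun h1 => h0 z hz (by rw [← h, h1]; simp)
  have hc : ContinuousAt s z := hs.continuousAt (hU.mem_nhds hz)
  have hd := ((hφ z hz).differentiableAt (hU.mem_nhds hz)).hasDerivAt
  suffices HasDerivAt s (deriv φ z / (s z + s z)) z from
    this.differentiableAt.differentiableWithinAt
  rw [hasDerivAt_iff_tendsto_slope] at hd ⊢
  have hsum : s z + s z ≠ 0 := by rw [← two_mul]; exact mul_ne_zero two_ne_zero hsz
  have hc' : ContinuousAt (fun w => s w + s z) z := hc.add continuousAt_const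
  refine (hd.div (hc'.tendsto.mono_left nhdsWithin_le_nhds) hsum).congr' ?_
  filter_upwards [nhdsWithin_le_nhds (hc'.eventually_ne hsum)] with w hw
  rw [Pi.div_apply, slope_def_field, slope_def_field, ← h, ← h]
  field_simp
  ring

/-- Holomorphic lifting through `z ↦ ζ z + z²` over a half plane that avoids the critical value
`-ζ² / 4`. The sign of the square root is chosen so that the lift is compatible with a given
lift `ψ` of `φ ∘ G`. -/
theorem exists_quadMap_lift {R : ℝ} {ζ : ℂ} {φ G ψ : ℂ → ℂ}
    (hφ : DifferentiableOn ℂ φ {Z | R < Z.re}) (hcv : ∀ Z : ℂ, R < Z.re → φ Z ≠ -ζ ^ 2 / 4)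
    (hG : ContinuousOn G {Z | R < Z.re}) (hGm : ∀ Z : ℂ, R < Z.re → R < (G Z).re)
    (hψ : ContinuousOn ψ {Z | R < Z.re})
    (hψφ : ∀ Z : ℂ, R < Z.re → quadMap ζ (ψ Z) = φ (G Z)) :
    ∃ S : ℂ → ℂ, DifferentiableOn ℂ S {Z | R < Z.re} ∧
      (∀ Z : ℂ, R < Z.re → quadMap ζ (S Z) = φ Z) ∧ ∀ Z : ℂ, R < Z.re → S (G Z) = ψ Z := by
  set H : Set ℂ := {Z | R < Z.re}
  have hHo : IsOpen H := isOpen_lt continuous_const Complex.continuous_re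
  have hHc : Convex ℝ H := convex_halfSpace_re_gt R
  have hHne : H.Nonempty := ⟨((R + 1 : ℝ) : ℂ), by simp [H]⟩
  have hHs : IsSimplyConnected H := by
    have := hHc.contractibleSpace hHne
    exact (inferInstance : SimplyConnectedSpace H)
  have h0 : ∀ Z ∈ H, φ Z + ζ ^ 2 / 4 ≠ 0 := fun Z hZ h => hcv Z hZ (by linear_combination h)
  have hφ' : DifferentiableOn ℂ (fun Z => φ Z + ζ ^ 2 / 4) H := hφ.add_const _
  obtain ⟨s, hsc, hs⟩ := Complex.exists_continuousOn_pow_eq hHs hHo hφ'.continuousOn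
    (by rintro ⟨Z, hZ, h⟩; exact h0 Z hZ h) two_ne_zero
  have hsd : DifferentiableOn ℂ s H := differentiableOn_of_sq_eq hHo hsc hφ' hs h0
  have hsG : ContinuousOn (fun Z => s (G Z)) H := hsc.comp hG hGm
  have hsq : Set.EqOn ((fun Z => ψ Z + ζ / 2) ^ 2) ((fun Z => s (G Z)) ^ 2) H := by
    intro Z hZ
    simp only [Pi.pow_apply, hs, ← hψφ Z hZ, quadMap]
    ring
  rcases hHc.isPreconnected.eq_or_eq_neg_of_sq_eq (hψ.add continuousOn_const) hsG hsq
    (fun {Z} hZ h => h0 _ (hGm Z hZ) (by rw [← hs, h]; simp)) with h | h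
  · refine ⟨fun Z => s Z - ζ / 2, hsd.sub_const _, fun Z _ => ?_, fun Z hZ => ?_⟩
    · have := hs Z
      simp only [quadMap]
      linear_combination this
    · have := h hZ
      rw [Pi.add_apply] at this
      linear_combination -this
  · refine ⟨fun Z => -s Z - ζ / 2, hsd.neg.sub_const _, fun Z _ => ?_, fun Z hZ => ?_⟩
    · have := hs Z
      simp only [quadMap]
      linear_combination this
    · have := h hZ
      rw [Pi.add_apply, Pi.neg_apply] at this
      linear_combination -this

theorem pow_mul_norm_le_norm_iterate_quadMap {c z : ℂ} (h : ‖c‖ + 3 ≤ ‖z‖) (n : ℕ) :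
    3 ^ n * ‖z‖ ≤ ‖(quadMap c)^[n] z‖ := by
  induction n with
  | zero => simp
  | succ n ih =>
    rw [Function.iterate_succ_apply']
    set w := (quadMap c)^[n] z
    have h1 : quadMap c w = w * (w + c) := by simp only [quadMap]; ring
    have h2 : ‖w‖ - ‖c‖ ≤ ‖w + c‖ := by
      have := norm_sub_le (w + c) c
      rw [add_sub_cancel_right] at this
      linarith
    have h3 : ‖z‖ ≤ ‖w‖ :=
      (le_mul_of_one_le_left (norm_nonneg z) (one_le_pow₀ (by norm_num))).trans ih
    rw [h1, norm_mul, pow_succ]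
    nlinarith [norm_nonneg w]

theorem norm_le_four_of_iterate_quadMap {ζ : ℂ} (hζ : ‖ζ‖ = 1) {n : ℕ} {z : ℂ}
    (h : ‖(quadMap ζ)^[n] z‖ ≤ 1) : ‖z‖ ≤ 4 := by
  by_contra! hz
  have h1 := pow_mul_norm_le_norm_iterate_quadMap (c := ζ) (z := z) (by linarith) n
  have h2 := le_mul_of_one_le_left (norm_nonneg z)
    (one_le_pow₀ (show (1 : ℝ) ≤ 3 by norm_num) (n := n))
  linarith

/-! ### The critical orbit and the number of petals -/

/-- Every attracting petal of a parabolic fixed point captures the orbit of the critical value.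
Otherwise the petal parametrisation lifts through all iterates on a half plane; the lifts are
bounded, and the Schwarz lemma on discs of linearly growing radius makes the parametrisation
constant. -/
theorem exists_iterate_critValue_mem_petal {ζ : ℂ} (hζ : ‖ζ‖ = 1) {q m : ℕ} (hm : 0 < m)
    {κ : ℂ} (hκ : κ ≠ 0) {R : ℝ} {G : ℂ → ℂ} (hR : 0 < R)
    (hE : Tendsto (fun Z => G Z - Z - 1) (Bornology.cobounded ℂ) (𝓝 0))
    (hGτ : ∀ Z : ℂ, R < Z.re → petal m κ (G Z) = (quadMap ζ)^[q] (petal m κ Z))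
    (hG : ∀ Z : ℂ, R < Z.re → ‖G Z - Z - 1‖ ≤ 1 / 4) (hGc : ∀ Z : ℂ, R < Z.re → ContinuousAt G Z)
    (hτ : ∀ Z : ℂ, R < Z.re → ‖petal m κ Z‖ ≤ 1) :
    ∃ (j : ℕ) (Z : ℂ), R < Z.re ∧ (quadMap ζ)^[j] (-ζ ^ 2 / 4) = petal m κ Z := by
  by_contra! hcon
  set H : Set ℂ := {Z | R < Z.re}
  set τ := petal m κ
  have hτd : DifferentiableOn ℂ τ H := fun Z hZ =>
    (differentiableAt_petal m κ (Or.inl (hR.trans hZ))).differentiableWithinAt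
  have hGn : ∀ (n : ℕ) (Z : ℂ), R < Z.re → R < (G^[n] Z).re := fun n Z hZ =>
    hZ.trans_le (le_trans (by simp) ((iterate_perturbed_translation hE hG hZ).1 n))
  have hGnc : ∀ n : ℕ, ContinuousOn G^[n] H := fun n =>
    ContinuousOn.iterate (fun Z hZ => (hGc Z hZ).continuousWithinAt) (fun Z hZ => hGn 1 Z hZ) n
  have hτn : ∀ (n : ℕ) (Z : ℂ), R < Z.re → τ (G^[n] Z) = (quadMap ζ)^[q * n] (τ Z) := by
    intro n Z hZ
    induction n with
    | zero => simp
    | succ n ih =>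
      rw [Function.iterate_succ_apply', hGτ _ (hGn n Z hZ), ih, ← Function.iterate_add_apply,
        mul_add, mul_one, add_comm]
  have hlift : ∀ n j : ℕ, j ≤ q * n → ∃ S : ℂ → ℂ, DifferentiableOn ℂ S H ∧
      (∀ Z : ℂ, R < Z.re → (quadMap ζ)^[j] (S Z) = τ Z) ∧
      ∀ Z : ℂ, R < Z.re → S (G^[n] Z) = (quadMap ζ)^[q * n - j] (τ Z) := by
    intro n j
    induction j with
    | zero => exact fun _ => ⟨τ, hτd, fun _ _ => rfl, hτn n⟩
    | succ j ih =>
      intro hj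
      obtain ⟨S, hS, h1, h2⟩ := ih (by omega)
      obtain ⟨T, hT, h3, h4⟩ := exists_quadMap_lift hS
        (fun Z hZ h => hcon j Z hZ (by rw [← h, h1 Z hZ])) (hGnc n) (hGn n)
        (ψ := fun Z => (quadMap ζ)^[q * n - (j + 1)] (τ Z))
        ((differentiable_iterate_quadMap _ ζ).continuous.comp_continuousOn hτd.continuousOn)
        (fun Z hZ => by
          rw [h2 Z hZ, show q * n - j = (q * n - (j + 1)).succ by omega,
            Function.iterate_succ_apply'])
      exact ⟨T, hT, fun Z hZ => by rw [Function.iterate_succ_apply, h3 Z hZ, h1 Z hZ], h4⟩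
  -- Two points with distinct images; their `G`-orbits stay within distance `o(n)`.
  set a : ℂ := ((R + 1 : ℝ) : ℂ)
  set b : ℂ := ((R + 2 : ℝ) : ℂ)
  have ha : R < a.re := by simp [a]
  have hb : R < b.re := by simp [b]
  have hlim : Tendsto (fun n : ℕ => ‖G^[n] b / n - G^[n] a / n‖) atTop (𝓝 0) := by
    have := ((iterate_perturbed_translation hE hG hb).2.sub
      (iterate_perturbed_translation hE hG ha).2).norm
    simpa using this
  have hbound : ∀ᶠ n : ℕ in atTop,
      dist (τ b) (τ a) ≤ 32 / 3 * ‖G^[n] b / n - G^[n] a / n‖ := by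
    filter_upwards [eventually_gt_atTop 0, hlim.eventually_lt_const (show (0 : ℝ) < 3 / 4 by
      norm_num)] with n hn hlt
    have hn' : (0 : ℝ) < n := Nat.cast_pos.2 hn
    obtain ⟨S, hS, h1, h2⟩ := hlift n (q * n) le_rfl
    simp only [Nat.sub_self, Function.iterate_zero, id] at h2
    have hSb : ∀ Z : ℂ, R < Z.re → ‖S Z‖ ≤ 4 := fun Z hZ =>
      norm_le_four_of_iterate_quadMap hζ (by rw [h1 Z hZ]; exact hτ Z hZ)
    have hball : Metric.ball (G^[n] a) (3 / 4 * n) ⊆ H := by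
      intro Z hZ
      have h3 := (iterate_perturbed_translation hE hG ha).1 n
      rw [Metric.mem_ball, dist_eq_norm] at hZ
      have h4 := (abs_lt.1 ((Complex.abs_re_le_norm _).trans_lt hZ)).1
      rw [Complex.sub_re] at h4
      change R < Z.re
      linarith
    have hnorm : ‖G^[n] b / n - G^[n] a / n‖ = dist (G^[n] b) (G^[n] a) / n := by
      rw [← sub_div, norm_div, Complex.norm_natCast, dist_eq_norm]
    rw [hnorm, div_lt_iff₀ hn'] at hlt
    have h5 := Complex.dist_le_div_mul_dist_of_mapsTo_ball (R₂ := 8) (hS.mono hball)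
      (fun Z hZ => by
        rw [Metric.mem_closedBall, dist_eq_norm]
        have := norm_sub_le (S Z) (S (G^[n] a))
        linarith [hSb Z (hball hZ), hSb _ (hGn n a ha)]) (Metric.mem_ball.2 hlt)
    rw [h2 b hb, h2 a ha] at h5
    rw [hnorm]
    refine h5.trans_eq ?_
    field_simp
    ring
  have hzero : dist (τ b) (τ a) ≤ 0 := by
    have := hlim.const_mul (32 / 3)
    rw [mul_zero] at this
    exact ge_of_tendsto this hbound
  have heq : τ b = τ a := dist_le_zero.1 hzero
  have ha0 : a ≠ 0 := fun h => by rw [h] at ha; simp at ha; linarith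
  have hb0 : b ≠ 0 := fun h => by rw [h] at hb; simp at hb; linarith
  have h6 : κ ^ m / b = κ ^ m / a := by
    rw [← petal_pow hm κ hb0, ← petal_pow hm κ ha0]
    exact congrArg (· ^ m) heq
  have h7 : a = b := by
    rw [div_eq_div_iff hb0 ha0] at h6
    exact mul_left_cancel₀ (pow_ne_zero m hκ) h6
  have h8 := congrArg Complex.re h7
  simp [a, b] at h8

theorem tendsto_exp_log_shift {m : ℕ} (k : ℕ) :
    Tendsto (fun n : ℕ => Complex.exp (Complex.log n / m) /
      Complex.exp (Complex.log (n + k : ℕ) / m)) atTop (𝓝 1) := by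
  have h1 : Tendsto (fun n : ℕ => ((n + k : ℕ) : ℂ) / n) atTop (𝓝 1) := by
    have h2 : Tendsto (fun n : ℕ => 1 + (k : ℂ) / n) atTop (𝓝 (1 + 0)) :=
      (tendsto_const_div_atTop_nhds_zero_nat (k : ℂ)).const_add 1
    rw [add_zero] at h2
    refine h2.congr' ?_
    filter_upwards [eventually_gt_atTop 0] with n hn
    have : (n : ℂ) ≠ 0 := Nat.cast_ne_zero.2 hn.ne'
    push_cast
    field_simp
  have h2 : Tendsto (fun n : ℕ => Complex.exp (-Complex.log (((n + k : ℕ) : ℂ) / n) / m)) atTop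
      (𝓝 (Complex.exp (-Complex.log 1 / m))) := ((h1.clog (by simp)).neg.div_const _).cexp
  simp only [Complex.log_one, neg_zero, zero_div, Complex.exp_zero] at h2
  refine h2.congr' ?_
  filter_upwards [eventually_gt_atTop 0] with n hn
  have hn' : (0 : ℝ) < n := Nat.cast_pos.2 hn
  have hn0 : (n : ℂ) ≠ 0 := Nat.cast_ne_zero.2 hn.ne'
  have hnk : ((n + k : ℕ) : ℂ) ≠ 0 := Nat.cast_ne_zero.2 (by omega)
  have h3 : Complex.log ((n + k : ℕ) : ℂ) =
      Complex.log n + Complex.log (((n + k : ℕ) : ℂ) / n) := by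
    have h4 := Complex.log_ofReal_mul hn' (div_ne_zero hnk hn0)
    rw [Complex.ofReal_natCast, mul_div_cancel₀ _ hn0] at h4
    rw [h4, Complex.ofReal_log hn'.le, Complex.ofReal_natCast]
  rw [← Complex.exp_sub, h3]
  congr 1
  ring

/-- `w` is attracted to `0` under the `q`-th iterate in the direction `κ`, at the rate
`n ^ (-1 / m)` of a parabolic point with `m` petals. -/
def AttractedAlong (ζ : ℂ) (q m : ℕ) (w κ : ℂ) : Prop :=
  Tendsto (fun n : ℕ => Complex.exp (Complex.log n / m) * (quadMap ζ)^[q * n] w) atTop (𝓝 κ)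

theorem AttractedAlong.apply_quadMap {ζ : ℂ} {q m : ℕ} (hm : 0 < m) {w κ : ℂ}
    (h : AttractedAlong ζ q m w κ) :
    AttractedAlong ζ q m (quadMap ζ w) (ζ * κ) := by
  have hm' : (0 : ℝ) < m := Nat.cast_pos.2 hm
  have hinv : Tendsto (fun n : ℕ => (Complex.exp (Complex.log n / m))⁻¹) atTop (𝓝 0) := by
    have h1 : Tendsto (fun n : ℕ => Real.exp (-(Real.log n / m))) atTop (𝓝 0) :=
      Real.tendsto_exp_neg_atTop_nhds_zero.comp
        ((Real.tendsto_log_atTop.comp tendsto_natCast_atTop_atTop).atTop_div_const hm')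
    rw [tendsto_zero_iff_norm_tendsto_zero]
    refine h1.congr fun n => ?_
    rw [← Complex.exp_neg, Complex.norm_exp, Complex.neg_re, ← Complex.ofReal_natCast m,
      Complex.div_ofReal_re, Complex.log_re, Complex.norm_natCast]
  have h0 : Tendsto (fun n : ℕ => (quadMap ζ)^[q * n] w) atTop (𝓝 0) := by
    have := hinv.mul h
    rw [zero_mul] at this
    refine this.congr fun n => ?_
    rw [← mul_assoc, inv_mul_cancel₀ (Complex.exp_ne_zero _), one_mul]
  have h2 := (h.const_mul ζ).add (h.mul h0)
  rw [mul_zero, add_zero] at h2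
  refine h2.congr fun n => ?_
  rw [← Function.iterate_succ_apply, Function.iterate_succ_apply', quadMap]
  ring

theorem AttractedAlong.iterate {ζ : ℂ} {q m : ℕ} (hm : 0 < m) {w κ : ℂ}
    (h : AttractedAlong ζ q m w κ) (j : ℕ) :
    AttractedAlong ζ q m ((quadMap ζ)^[j] w) (ζ ^ j * κ) := by
  induction j with
  | zero => simpa using h
  | succ j ih =>
    rw [Function.iterate_succ_apply', pow_succ', mul_assoc]
    exact ih.apply_quadMap hm

/-- Any direction along which a point of the forward orbit of `w` is attracted is, up to a power
of `ζ`, the direction along which `w` itself is attracted. -/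
theorem AttractedAlong.of_iterate {ζ : ℂ} {q m : ℕ} (hq : 0 < q) (hm : 0 < m) {w κ : ℂ} {j : ℕ}
    (h : AttractedAlong ζ q m ((quadMap ζ)^[j] w) κ) :
    AttractedAlong ζ q m w (ζ ^ ((q - 1) * j) * κ) := by
  have h1 := h.iterate hm ((q - 1) * j)
  have hqj : (q - 1) * j + j = q * j := by
    rw [Nat.sub_mul, one_mul, Nat.sub_add_cancel (Nat.le_mul_of_pos_left j hq)]
  rw [← Function.iterate_add_apply, hqj] at h1
  have h2 := (tendsto_exp_log_shift (m := m) j).inv₀ one_ne_zero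
  rw [inv_one] at h2
  have h3 := h2.mul h1
  rw [one_mul] at h3
  unfold AttractedAlong
  rw [← tendsto_add_atTop_iff_nat j]
  refine h3.congr fun n => ?_
  rw [← Function.iterate_add_apply, ← mul_add, inv_div, div_mul_eq_mul_div, mul_left_comm,
    mul_div_cancel_left₀ _ (Complex.exp_ne_zero _)]

/-- At a parabolic fixed point of the quadratic polynomial with multiplier `ζ`, `ζ ^ q = 1`, the
number `m` of attracting petals divides `q`: every attracting direction is the direction of
the critical value up to a power of `ζ`. -/
theorem petal_number_dvd {ζ : ℂ} {q m : ℕ} (hq : 0 < q) (hζ : ζ ^ q = 1) (hm : 0 < m)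
    {B : ℂ → ℂ} (hB : Continuous B) (hB0 : B 0 ≠ 0)
    (hg : ∀ z, (quadMap ζ)^[q] z = z + z ^ (m + 1) * B z) : m ∣ q := by
  have hm' : (m : ℂ) ≠ 0 := Nat.cast_ne_zero.2 hm.ne'
  have hζn : ‖ζ‖ = 1 := Complex.norm_eq_one_of_pow_eq_one hζ hq.ne'
  have key : ∀ κ : ℂ, κ ^ m = -1 / (m * B 0) →
      ∃ κ', AttractedAlong ζ q m (-ζ ^ 2 / 4) κ' ∧ κ' ^ q = κ ^ q := by
    intro κ hκ
    have hκ0 : κ ≠ 0 := by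
      rintro rfl
      rw [zero_pow hm.ne'] at hκ
      have : (-1 : ℂ) / (m * B 0) ≠ 0 := div_ne_zero (by norm_num) (mul_ne_zero hm' hB0)
      exact this hκ.symm
    obtain ⟨R, G, hR, hE, hG⟩ := exists_petal_conj hm (κ := κ) hB (by rw [hκ]; field_simp)
    have hGτ : ∀ Z : ℂ, R < Z.re → petal m κ (G Z) = (quadMap ζ)^[q] (petal m κ Z) :=
      fun Z hZ => by rw [hg, (hG Z hZ).1]
    obtain ⟨j, Z, hZ, hj⟩ := exists_iterate_critValue_mem_petal hζn hm hκ0 hR hE hGτ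
      (fun Z hZ => (hG Z hZ).2.1) (fun Z hZ => (hG Z hZ).2.2.1) (fun Z hZ => (hG Z hZ).2.2.2)
    obtain ⟨h1, h2⟩ := iterate_perturbed_translation hE (fun Z hZ => (hG Z hZ).2.1) hZ
    have h3 : AttractedAlong ζ q m ((quadMap ζ)^[j] (-ζ ^ 2 / 4)) κ := by
      refine (tendsto_rescaled_petal (m := m) (κ := κ) h2).congr fun n => ?_
      congr 1
      rw [hj]
      clear h2
      induction n with
      | zero => simp
      | succ n ih =>
        rw [Function.iterate_succ_apply', hGτ _ (hZ.trans_le (le_trans (by simp) (h1 n))), ih,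
          ← Function.iterate_add_apply, mul_add, mul_one, add_comm]
    refine ⟨_, h3.of_iterate hq hm, ?_⟩
    rw [mul_pow, ← pow_mul, mul_comm _ q, pow_mul, hζ, one_pow, one_mul]
  obtain ⟨κ, hκ⟩ := IsAlgClosed.exists_pow_nat_eq (-1 / (m * B 0)) hm
  set ξ : ℂ := Complex.exp (2 * Real.pi * Complex.I / m)
  have hξ : IsPrimitiveRoot ξ m := Complex.isPrimitiveRoot_exp m hm.ne'
  obtain ⟨κ₁, h1, h1'⟩ := key κ hκ
  obtain ⟨κ₂, h2, h2'⟩ := key (ξ * κ) (by rw [mul_pow, hξ.pow_eq_one, one_mul, hκ])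
  have hκ0 : κ ≠ 0 := by
    rintro rfl
    rw [zero_pow hm.ne'] at hκ
    have : (-1 : ℂ) / (m * B 0) ≠ 0 := div_ne_zero (by norm_num) (mul_ne_zero hm' hB0)
    exact this hκ.symm
  rw [tendsto_nhds_unique h2 h1, h1', mul_pow] at h2'
  exact hξ.dvd_of_pow_eq_one q (mul_right_cancel₀ (pow_ne_zero q hκ0) (by rw [← h2', one_mul]))

/-- The `q`-th iterate commutes with the map; comparing the coefficients of `z ^ (m + 1)` in this
relation gives `ζ ^ (m + 1) = ζ`. -/
theorem pow_petal_number_eq_one {ζ : ℂ} (hζ0 : ζ ≠ 0) {q m : ℕ}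
    {B : ℂ → ℂ} (hB : Continuous B) (hB0 : B 0 ≠ 0)
    (hg : ∀ z, (quadMap ζ)^[q] z = z + z ^ (m + 1) * B z) : ζ ^ m = 1 := by
  have hqc : Continuous (quadMap ζ) := by unfold quadMap; fun_prop
  have h1 : (fun z => ζ * B z + z * (2 * B z + z ^ m * B z ^ 2)) =
      fun z => (ζ + z) ^ (m + 1) * B (quadMap ζ z) := by
    refine Continuous.ext_on (dense_compl_singleton (0 : ℂ)) (by fun_prop) (by fun_prop) ?_
    intro z hz
    have hz : z ≠ 0 := hz
    have h2 : (quadMap ζ)^[q] (quadMap ζ z) = quadMap ζ ((quadMap ζ)^[q] z) := by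
      rw [← Function.iterate_succ_apply, Function.iterate_succ_apply']
    rw [hg, hg] at h2
    refine mul_left_cancel₀ (pow_ne_zero (m + 1) hz) ?_
    have h3 : quadMap ζ z ^ (m + 1) = z ^ (m + 1) * (ζ + z) ^ (m + 1) := by
      rw [← mul_pow, quadMap]; ring
    rw [h3] at h2
    have h4 : quadMap ζ (z + z ^ (m + 1) * B z) = quadMap ζ z + z ^ (m + 1) *
        (ζ * B z + z * (2 * B z + z ^ m * B z ^ 2)) := by
      simp only [quadMap]; ring
    rw [h4] at h2
    simp only
    linear_combination -h2
  have h2 := congrFun h1 0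
  simp only [zero_mul, add_zero, quadMap, mul_zero, zero_pow two_ne_zero, pow_succ] at h2
  have h3 : ζ * B 0 * (ζ ^ m - 1) = 0 := by linear_combination -h2
  rcases mul_eq_zero.1 h3 with h | h
  · exact absurd h (mul_ne_zero hζ0 hB0)
  · linear_combination h

/-- At a primitive `q`-th root of unity `ζ`, the quadratic polynomial with multiplier `ζ` has
exactly `q` attracting petals: its `q`-th iterate is `z + a z ^ (q + 1) + …` with `a ≠ 0`. -/
theorem exists_iterate_quadMap_parabolic {ζ : ℂ} {q : ℕ} (hq : 0 < q)
    (hζ : IsPrimitiveRoot ζ q) : ∃ b : ℂ[X], b.eval 0 ≠ 0 ∧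
      ∀ z, (quadMap ζ)^[q] z = z + z ^ (q + 1) * b.eval z := by
  set F : ℂ[X] := (fixPoly q).map (evalRingHom ζ)
  have hF0 : F ≠ 0 := ((fixPoly_monic_natDegree hq).1.map _).ne_zero
  have hroot : F.IsRoot 0 := by
    rw [IsRoot, eval_map_fixPoly]
    have : (quadMap ζ)^[q] 0 = 0 := Function.iterate_fixed (by simp [quadMap]) q
    rw [this, sub_zero]
  have hd : deriv (quadMap ζ)^[q] 0 = 1 := by
    have h1 : HasDerivAt (quadMap ζ) ζ 0 := by
      have := ((hasDerivAt_id (0 : ℂ)).const_mul ζ).fun_add (hasDerivAt_pow 2 (0 : ℂ))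
      simp only [id] at this
      exact this.congr_deriv (by simp)
    rw [(HasDerivAt.iterate 0 h1 (by simp [quadMap]) q).deriv, hζ.pow_eq_one]
  have hroot' : F.derivative.IsRoot 0 := by
    rw [IsRoot, eval_derivative_map_fixPoly, hd, sub_self]
  have hmult := (one_lt_rootMultiplicity_iff_isRoot hF0).2 ⟨hroot, hroot'⟩
  obtain ⟨b, hb, hndvd⟩ := exists_eq_pow_rootMultiplicity_mul_and_not_dvd F hF0 0
  obtain ⟨m, hm⟩ : ∃ m, F.rootMultiplicity 0 = m + 1 := ⟨F.rootMultiplicity 0 - 1, by omega⟩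
  have hm0 : 0 < m := by omega
  have hb0 : b.eval 0 ≠ 0 := fun h => hndvd (dvd_iff_isRoot.2 h)
  have hg : ∀ z, (quadMap ζ)^[q] z = z + z ^ (m + 1) * b.eval z := by
    intro z
    have h1 := eval_map_fixPoly q ζ z
    change F.eval z = _ at h1
    rw [hb, hm] at h1
    simp at h1
    linear_combination -h1
  have h1 : m ∣ q := petal_number_dvd hq hζ.pow_eq_one hm0 b.continuous hb0 hg
  have h2 : q ∣ m := hζ.dvd_of_pow_eq_one m
    (pow_petal_number_eq_one (hζ.ne_zero hq.ne') b.continuous hb0 hg)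
  obtain rfl := Nat.dvd_antisymm h1 h2
  exact ⟨b, hb0, hg⟩

/-! ### The local branch -/

/-- The analytic implicit function theorem for one equation in one unknown, including the local
uniqueness of the solution. -/
theorem exists_analytic_implicit {F : ℂ × ℂ → ℂ} {x₀ y₀ d : ℂ} (hF : ContDiffAt ℂ ω F (x₀, y₀))
    (hd : HasDerivAt (fun y => F (x₀, y)) d y₀) (hd0 : d ≠ 0) (h0 : F (x₀, y₀) = 0) :
    ∃ ψ : ℂ → ℂ, AnalyticAt ℂ ψ x₀ ∧ ψ x₀ = y₀ ∧
      ∀ᶠ v in 𝓝 (x₀, y₀), F v = 0 ↔ ψ v.1 = v.2 := by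
  have hω : (ω : WithTop ℕ∞) ≠ 0 := by simp
  have hinv : (fderiv ℂ F (x₀, y₀) ∘L .inr ℂ ℂ ℂ).IsInvertible := by
    refine ⟨ContinuousLinearEquiv.unitsEquivAut ℂ (Units.mk0 d hd0), ?_⟩
    have h1 : HasFDerivAt (fun y => F (x₀, y)) (fderiv ℂ F (x₀, y₀) ∘L .inr ℂ ℂ ℂ) y₀ :=
      ((hF.differentiableAt hω).hasFDerivAt).comp y₀ (hasFDerivAt_prodMk_right x₀ y₀)
    have h2 := h1.hasDerivAt.unique hd
    ext
    simpa using h2.symm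
  refine ⟨hF.implicitFunction hω hinv, ?_, hF.implicitFunction_apply_self hω hinv, ?_⟩
  · exact (hF.contDiffAt_implicitFunction hω hinv).analyticAt
  · have := hF.eventually_apply_eq_iff_implicitFunction hω hinv
    rwa [h0] at this

theorem eventually_eq_of_implicit {F : ℂ × ℂ → ℂ} {x₀ y₀ d : ℂ} (hF : ContDiffAt ℂ ω F (x₀, y₀))
    (hd : HasDerivAt (fun y => F (x₀, y)) d y₀) (hd0 : d ≠ 0) (h0 : F (x₀, y₀) = 0)
    {u v : ℂ → ℂ} (hu : ContinuousAt u x₀) (hv : ContinuousAt v x₀) (hu0 : u x₀ = y₀)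
    (hv0 : v x₀ = y₀) (hFu : ∀ᶠ x in 𝓝 x₀, F (x, u x) = 0) (hFv : ∀ᶠ x in 𝓝 x₀, F (x, v x) = 0) :
    u =ᶠ[𝓝 x₀] v := by
  obtain ⟨ψ, -, -, h⟩ := exists_analytic_implicit hF hd hd0 h0
  have h1 : Tendsto (fun x => (x, u x)) (𝓝 x₀) (𝓝 (x₀, y₀)) := by
    simpa only [hu0, id] using (continuousAt_id.prodMk hu).tendsto
  have h2 : Tendsto (fun x => (x, v x)) (𝓝 x₀) (𝓝 (x₀, y₀)) := by
    simpa only [hv0, id] using (continuousAt_id.prodMk hv).tendsto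
  filter_upwards [h1.eventually h, h2.eventually h, hFu, hFv] with x h3 h4 h5 h6
  rw [← h3.1 h5, ← h4.1 h6]

theorem analyticAt_of_implicit {F : ℂ × ℂ → ℂ} {x₀ d : ℂ} {u : ℂ → ℂ}
    (hF : ContDiffAt ℂ ω F (x₀, u x₀)) (hd : HasDerivAt (fun y => F (x₀, y)) d (u x₀))
    (hd0 : d ≠ 0) (hu : ContinuousAt u x₀) (hFu : ∀ᶠ x in 𝓝 x₀, F (x, u x) = 0) :
    AnalyticAt ℂ u x₀ := by
  obtain ⟨ψ, h1, h2, h⟩ := exists_analytic_implicit hF hd hd0 hFu.self_of_nhds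
  refine h1.congr ?_
  filter_upwards [(continuousAt_id.prodMk hu).tendsto.eventually h, hFu] with x h3 h4
  exact h3.1 h4

/-- The function whose zeros `(δ, z)` are the fixed points `z` of the `q`-th iterate for the
parameter `p / q + δ ^ q`. -/
noncomputable def fixFun (p : ℤ) (q : ℕ) (x : ℂ × ℂ) : ℂ :=
  (quadP ((p : ℂ) / q + x.1 ^ q))^[q] x.2 - x.2

theorem contDiff_fixFun (p : ℤ) (q : ℕ) : ContDiff ℂ ω (fixFun p q) := by
  have : ∀ n : ℕ, ContDiff ℂ ω fun x : ℂ × ℂ => (quadP ((p : ℂ) / q + x.1 ^ q))^[n] x.2 := by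
    intro n
    induction n with
    | zero => exact contDiff_snd
    | succ n ih =>
      simp only [Function.iterate_succ_apply']
      have : ContDiff ℂ ω fun x : ℂ × ℂ =>
          Complex.exp (2 * Real.pi * Complex.I * ((p : ℂ) / q + x.1 ^ q)) := by fun_prop
      exact (this.mul ih).add (ih.pow 2)
  exact (this q).sub contDiff_snd

theorem hasDerivAt_fixFun (p : ℤ) (q : ℕ) (δ z : ℂ) :
    HasDerivAt (fun y => fixFun p q (δ, y))
      (deriv (quadP ((p : ℂ) / q + δ ^ q))^[q] z - 1) z := by
  have h := (differentiable_iterate_quadMap q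
    (Complex.exp (2 * Real.pi * Complex.I * ((p : ℂ) / q + δ ^ q))) z).hasDerivAt
  exact h.sub (hasDerivAt_id z)

/-- Desingularisation at the parabolic parameter: after the substitution `z = δ y` the fixed point
equation is divisible by `δ ^ (q + 1) y`, and the quotient `H` is `2πi q + a y ^ q` at `δ = 0`,
which has a simple nonzero root. -/
theorem exists_fixFun_desingularization {p : ℤ} {q : ℕ} (hq : 0 < q)
    (hpq : IsCoprime p (q : ℤ)) :
    ∃ H : ℂ × ℂ → ℂ, ContDiff ℂ ω H ∧
      (∀ δ y, fixFun p q (δ, δ * y) = δ ^ (q + 1) * y * H (δ, y)) ∧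
      ∃ y₀ d : ℂ, y₀ ≠ 0 ∧ H (0, y₀) = 0 ∧ d ≠ 0 ∧ HasDerivAt (fun y => H (0, y)) d y₀ := by
  have hq' : (q : ℂ) ≠ 0 := Nat.cast_ne_zero.2 hq.ne'
  set ζ : ℂ := Complex.exp (2 * Real.pi * Complex.I * ((p : ℂ) / q))
  have hζ : IsPrimitiveRoot ζ q := Complex.isPrimitiveRoot_exp_of_isCoprime p q hq.ne' hpq
  obtain ⟨b, hb0, hb⟩ := exists_iterate_quadMap_parabolic hq hζ
  obtain ⟨A, hA, hA0, hAeq⟩ := exists_iterate_quadMap_sub_eq ζ q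
  set a := b.eval 0
  set μ : ℂ → ℂ := fun δ =>
    ζ * (2 * Real.pi * Complex.I * dslope Complex.exp 0 (2 * Real.pi * Complex.I * δ ^ q))
  set c : ℂ → ℂ := fun δ => Complex.exp (2 * Real.pi * Complex.I * ((p : ℂ) / q + δ ^ q))
  have hc0 : c 0 = ζ := by simp [c, ζ, hq.ne']
  have hμ0 : μ 0 = ζ * (2 * Real.pi * Complex.I) := by
    simp [μ, hq.ne', (Complex.hasDerivAt_exp 0).deriv]
  have hcμ : ∀ δ, c δ - ζ = δ ^ q * μ δ := by
    intro δ
    have h1 := sub_smul_dslope Complex.exp 0 (2 * Real.pi * Complex.I * δ ^ q)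
    rw [sub_zero, smul_eq_mul, Complex.exp_zero] at h1
    have h2 : c δ = ζ * Complex.exp (2 * Real.pi * Complex.I * δ ^ q) := by
      simp only [c, ζ, mul_add, Complex.exp_add]
    rw [h2]
    simp only [μ]
    linear_combination -ζ * h1
  have hdsl : ContDiff ℂ ω (dslope Complex.exp 0) := by
    have : DifferentiableOn ℂ (dslope Complex.exp 0) Set.univ :=
      (Complex.differentiableOn_dslope univ_mem).2 Complex.differentiable_exp.differentiableOn
    exact (differentiableOn_univ.1 this).contDiff
  have hc : ContDiff ℂ ω c := by simp only [c]; fun_prop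
  have hμ : ContDiff ℂ ω μ := by
    have : ContDiff ℂ ω fun δ : ℂ => 2 * Real.pi * Complex.I * δ ^ q := by fun_prop
    exact contDiff_const.mul (contDiff_const.mul (hdsl.comp this))
  have hbc : ContDiff ℂ ω fun z => b.eval z := b.differentiable.contDiff
  refine ⟨fun x => μ x.1 * A (c x.1, x.1 * x.2) + x.2 ^ q * b.eval (x.1 * x.2), ?_, ?_, ?_⟩
  · have h1 : ContDiff ℂ ω fun x : ℂ × ℂ => A (c x.1, x.1 * x.2) :=
      hA.comp ((hc.comp contDiff_fst).prodMk (contDiff_fst.mul contDiff_snd))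
    exact ((hμ.comp contDiff_fst).mul h1).add
      ((contDiff_snd.pow q).mul (hbc.comp (contDiff_fst.mul contDiff_snd)))
  · intro δ y
    have h1 := hAeq (c δ) (δ * y)
    rw [hb, hcμ] at h1
    simp only [fixFun, quadP_eq_quadMap]
    linear_combination h1
  · have hval : ∀ y : ℂ, μ 0 * A (c 0, 0 * y) + y ^ q * b.eval (0 * y) =
        2 * Real.pi * Complex.I * q + a * y ^ q := by
      intro y
      have hζq : ζ * ζ ^ (q - 1) = 1 := by
        rw [← pow_succ', Nat.sub_add_cancel hq, hζ.pow_eq_one]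
      rw [zero_mul, hc0, hμ0, hA0]
      linear_combination (2 * Real.pi * Complex.I * q) * hζq
    obtain ⟨y₀, hy₀⟩ := IsAlgClosed.exists_pow_nat_eq (-(2 * Real.pi * Complex.I * q) / a) hq
    have hne : -(2 * Real.pi * Complex.I * q) / a ≠ 0 :=
      div_ne_zero (neg_ne_zero.2 (mul_ne_zero Complex.two_pi_I_ne_zero hq')) hb0
    have hy0 : y₀ ≠ 0 := by
      rintro rfl
      rw [zero_pow hq.ne'] at hy₀
      exact hne hy₀.symm
    refine ⟨y₀, a * (q * y₀ ^ (q - 1)), hy0, ?_, ?_, ?_⟩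
    · refine (hval y₀).trans ?_
      rw [hy₀, mul_div_cancel₀ _ hb0, add_neg_cancel]
    · exact mul_ne_zero hb0 (mul_ne_zero hq' (pow_ne_zero _ hy0))
    · simp only [hval]
      exact ((hasDerivAt_pow q y₀).const_mul a).const_add _

/-- The cycle of period `q` bifurcating from `0`, near the parabolic parameter. -/
theorem exists_local_branch {p : ℤ} {q : ℕ} (hq : 0 < q) (hpq : IsCoprime p (q : ℤ))
    {ζ : ℂ} (hζ : ζ = Complex.exp (2 * Real.pi * Complex.I * ((p : ℂ) / q))) :
    ∃ χ : ℂ → ℂ, AnalyticAt ℂ χ 0 ∧ χ 0 = 0 ∧ deriv χ 0 ≠ 0 ∧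
      (∀ᶠ δ in 𝓝 0, fixFun p q (δ, χ δ) = 0) ∧
      ∀ᶠ δ in 𝓝 0, quadP ((p : ℂ) / q + δ ^ q) (χ δ) = χ (ζ * δ) := by
  obtain ⟨H, hH, hfix, y₀, d, hy0, hH0, hd0, hd⟩ := exists_fixFun_desingularization hq hpq
  have hζq : ζ ^ q = 1 := by
    rw [hζ]
    exact (Complex.isPrimitiveRoot_exp_of_isCoprime p q hq.ne' hpq).pow_eq_one
  have hζ0 : ζ ≠ 0 := hζ ▸ Complex.exp_ne_zero _
  obtain ⟨y, hy, hyy, hyH⟩ := exists_analytic_implicit hH.contDiffAt hd hd0 hH0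
  have hyc : Tendsto (fun δ => (δ, y δ)) (𝓝 0) (𝓝 (0, y₀)) := by
    simpa only [hyy, id] using (continuousAt_id.prodMk hy.continuousAt).tendsto
  have hHy : ∀ᶠ δ in 𝓝 0, H (δ, y δ) = 0 := by
    filter_upwards [hyc.eventually hyH] with δ h
    exact h.2 rfl
  have hder : HasDerivAt (fun δ => δ * y δ) y₀ 0 := by
    have := (hasDerivAt_id (0 : ℂ)).mul hy.differentiableAt.hasDerivAt
    simp only [id, hyy, zero_mul, one_mul, add_zero] at this
    exact this
  refine ⟨fun δ => δ * y δ, analyticAt_id.mul hy, by simp, by rwa [hder.deriv], ?_, ?_⟩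
  · filter_upwards [hHy] with δ h
    rw [hfix, h, mul_zero]
  · -- The image of the branch, written as a branch at `ζ δ`, solves the same equation `H = 0`.
    set c : ℂ → ℂ := fun δ => Complex.exp (2 * Real.pi * Complex.I * ((p : ℂ) / q + δ ^ q))
    set v : ℂ → ℂ := fun δ => y δ * (c δ + δ * y δ) / ζ
    have hcc : Continuous c := by simp only [c]; fun_prop
    have hv : ContinuousAt v 0 := ((hy.continuousAt.mul
      (hcc.continuousAt.add (continuousAt_id.mul hy.continuousAt)))).div_const ζ
    have hv0 : v 0 = y₀ := by
      have : c 0 = ζ := by simp [c, hζ, hq.ne']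
      simp only [v, this, hyy, zero_mul, add_zero]
      field_simp
    have hvc : Tendsto (fun δ => (ζ * δ, v δ)) (𝓝 0) (𝓝 (0, y₀)) := by
      have : ContinuousAt (fun δ => (ζ * δ, v δ)) 0 :=
        (continuousAt_const.mul continuousAt_id).prodMk hv
      simpa only [hv0, mul_zero] using this.tendsto
    filter_upwards [hvc.eventually hyH, hHy, hv.eventually_ne (hv0.symm ▸ hy0)] with δ h1 h2 h3
    have h4 : quadP ((p : ℂ) / q + δ ^ q) (δ * y δ) = ζ * δ * v δ := by
      simp only [quadP, v]
      change c δ * (δ * y δ) + (δ * y δ) ^ 2 = _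
      field_simp
    rw [h4]
    rcases eq_or_ne δ 0 with rfl | hδ
    · simp
    · have h5 : fixFun p q (ζ * δ, ζ * δ * v δ) = 0 := by
        have h6 : fixFun p q (δ, δ * y δ) = 0 := by rw [hfix, h2, mul_zero]
        rw [fixFun, sub_eq_zero] at h6
        rw [fixFun, ← h4]
        simp only [mul_pow, hζq, one_mul]
        rw [← Function.iterate_succ_apply, Function.iterate_succ_apply', h6, sub_self]
      rw [hfix] at h5
      have h7 : H (ζ * δ, v δ) = 0 := by
        rcases mul_eq_zero.1 h5 with h | h
        · exact absurd h (mul_ne_zero (pow_ne_zero _ (mul_ne_zero hζ0 hδ)) h3)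
        · exact h
      rw [← h1.1 h7]

/-! ### Analytic continuation of the branch -/

/-- The map `(δ, z) ↦ (δ, fixFun (δ, z))`, whose fibres over `(δ, 0)` are the sets of fixed
points. -/
noncomputable def fixMap (p : ℤ) (q : ℕ) (x : ℂ × ℂ) : ℂ × ℂ := (x.1, fixFun p q x)

theorem isProperMap_fixMap (p : ℤ) {q : ℕ} (hq : 0 < q) : IsProperMap (fixMap p q) := by
  have hF : Continuous (fixFun p q) := (contDiff_fixFun p q).continuous
  have hcont : Continuous (fixMap p q) := continuous_fst.prodMk hF
  refine isProperMap_iff_isCompact_preimage.2 ⟨hcont, fun K hK => ?_⟩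
  set c : ℂ × ℂ → ℂ := fun x => Complex.exp (2 * Real.pi * Complex.I * ((p : ℂ) / q + x.1 ^ q))
  have hc : Continuous c := by simp only [c]; fun_prop
  obtain ⟨M, hM⟩ := hK.exists_bound_of_continuousOn hc.continuousOn
  obtain ⟨N, hN⟩ := hK.exists_bound_of_continuousOn continuous_snd.continuousOn
  refine ((hK.image continuous_fst).prod
    (isCompact_closedBall (0 : ℂ) (M + 3 + N))).of_isClosed_subset (hK.isClosed.preimage hcont) fun x hx => ⟨⟨_, hx, rfl⟩, ?_⟩
  rw [mem_closedBall_zero_iff]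
  by_contra! hz
  have h1 : ‖c x‖ ≤ M := hM (fixMap p q x) hx
  have h2 : ‖fixFun p q x‖ ≤ N := hN (fixMap p q x) hx
  have h3 := pow_mul_norm_le_norm_iterate_quadMap (c := c x) (z := x.2)
    (by linarith [norm_nonneg (fixFun p q x)]) q
  have h4 : (quadMap (c x))^[q] x.2 = fixFun p q x + x.2 := by
    rw [fixFun, sub_add_cancel, quadP_eq_quadMap]
  have h5 := norm_add_le (fixFun p q x) x.2
  have h6 : (3 : ℝ) ≤ 3 ^ q := le_self_pow₀ (by norm_num) hq.ne'
  rw [h4] at h3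
  nlinarith [norm_nonneg (c x), norm_nonneg x.2]

/-- Where all fixed points of the `q`-th iterate are simple, they form a covering of
the set `s` of parameters. -/
theorem isCoveringMapOn_fixMap (p : ℤ) {q : ℕ} (hq : 0 < q) {s : Set ℂ}
    (hs : ∀ δ ∈ s, ∀ z, fixFun p q (δ, z) = 0 →
      deriv (quadP ((p : ℂ) / q + δ ^ q))^[q] z ≠ 1) :
    IsCoveringMapOn (fixMap p q) (s ×ˢ {0}) := by
  have hω : (ω : WithTop ℕ∞) ≠ 0 := by simp
  refine (isProperMap_fixMap p hq).isClosedMap.isCoveringMapOn_of_isLocalHomeomorphOn ?_ ?_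
  · rintro ⟨δ, w⟩ ⟨-, hw⟩
    obtain rfl : w = 0 := hw
    set P := (fixPoly q).map
      (evalRingHom (Complex.exp (2 * Real.pi * Complex.I * ((p : ℂ) / q + δ ^ q))))
    have hP : P ≠ 0 := ((fixPoly_monic_natDegree hq).1.map _).ne_zero
    refine ((Set.finite_singleton δ).prod (finite_setOfPred_isRoot hP)).subset ?_
    rintro ⟨δ', z⟩ hx
    obtain ⟨h1, h2⟩ := Prod.mk.inj (show ((δ', fixFun p q (δ', z)) : ℂ × ℂ) = (δ, 0) from hx)
    subst h1
    refine ⟨rfl, ?_⟩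
    change P.eval z = 0
    rw [eval_map_fixPoly, ← h2]
    rfl
  · rintro ⟨δ, z⟩ ⟨hδ, hz⟩
    have hd0 : deriv (quadP ((p : ℂ) / q + δ ^ q))^[q] z - 1 ≠ 0 := sub_ne_zero.2 (hs δ hδ z hz)
    have hF : HasStrictFDerivAt (fixFun p q) (fderiv ℂ (fixFun p q) (δ, z)) (δ, z) :=
      (contDiff_fixFun p q).contDiffAt.hasStrictFDerivAt hω
    set L := fderiv ℂ (fixFun p q) (δ, z)
    have hL : ∀ y, L (0, y) = (deriv (quadP ((p : ℂ) / q + δ ^ q))^[q] z - 1) * y := by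
      intro y
      have h1 : HasFDerivAt (fun y => fixFun p q (δ, y)) (L ∘L .inr ℂ ℂ ℂ) z :=
        hF.hasFDerivAt.comp z (hasFDerivAt_prodMk_right δ z)
      have h2 := h1.hasDerivAt.unique (hasDerivAt_fixFun p q δ z)
      have h3 : L (0, y) = y • (L ∘L .inr ℂ ℂ ℂ) 1 := by
        rw [← map_smul]; simp
      rw [h3, h2, smul_eq_mul, mul_comm]
    set T : ℂ × ℂ →L[ℂ] ℂ × ℂ := (ContinuousLinearMap.fst ℂ ℂ ℂ).prod L
    have hT : HasStrictFDerivAt (fixMap p q) T (δ, z) := hasStrictFDerivAt_fst.prodMk hF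
    have hinj : Function.Injective (T : ℂ × ℂ →ₗ[ℂ] ℂ × ℂ) := by
      rw [← LinearMap.ker_eq_bot, LinearMap.ker_eq_bot']
      rintro ⟨u, v⟩ h
      obtain ⟨h1, h2⟩ := Prod.mk.inj (show (u, L (u, v)) = (0, 0) from h)
      subst h1
      rw [hL] at h2
      rw [(mul_eq_zero.1 h2).resolve_left hd0]
      rfl
    set e := (LinearEquiv.ofInjectiveEndo (T : ℂ × ℂ →ₗ[ℂ] ℂ × ℂ) hinj).toContinuousLinearEquiv
    have he : (e : ℂ × ℂ →L[ℂ] ℂ × ℂ) = T := by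
      ext <;> simp [e]
    have hT' : HasStrictFDerivAt (fixMap p q) (e : ℂ × ℂ →L[ℂ] ℂ × ℂ) (δ, z) := by rwa [he]
    exact ⟨hT'.toOpenPartialHomeomorph _, hT'.mem_toOpenPartialHomeomorph_source, by simp⟩

/-- Analytic continuation of a branch of fixed points to a disc: the branch is continued along
radii by homotopy lifting, starting from a small disc around the centre. -/
theorem exists_continuation_of_branch (p : ℤ) {q : ℕ} (hq : 0 < q) {r : ℝ} (hr : 0 < r)
    (hs : ∀ δ ∈ Metric.ball (0 : ℂ) r \ {0}, ∀ z, fixFun p q (δ, z) = 0 →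
      deriv (quadP ((p : ℂ) / q + δ ^ q))^[q] z ≠ 1)
    {χ₀ : ℂ → ℂ} (han : AnalyticAt ℂ χ₀ 0) (hfix : ∀ᶠ δ in 𝓝 0, fixFun p q (δ, χ₀ δ) = 0) :
    ∃ χ : ℂ → ℂ, AnalyticOnNhd ℂ χ (Metric.ball 0 r) ∧ χ =ᶠ[𝓝 0] χ₀ ∧
      ∀ δ ∈ Metric.ball (0 : ℂ) r, fixFun p q (δ, χ δ) = 0 := by
  classical
  set D : Set ℂ := Metric.ball (0 : ℂ) r \ {0}
  have hDo : IsOpen D := Metric.isOpen_ball.sdiff isClosed_singleton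
  obtain ⟨ρ, hρ, hρb⟩ := Metric.eventually_nhds_iff_ball.1
    (han.eventually_analyticAt.and hfix)
  set ε : ℝ := ρ / 2
  have hε : 0 < ε := half_pos hρ
  -- The radial factor that moves `δ` into the closed disc of radius `ε`.
  set k : D → ℝ := fun δ => min 1 (ε / ‖(δ : ℂ)‖)
  have hnorm : ∀ δ : D, 0 < ‖(δ : ℂ)‖ := fun δ => norm_pos_iff.2 δ.2.2
  have hk0 : ∀ δ, 0 < k δ := fun δ => lt_min one_pos (div_pos hε (hnorm δ))
  have hk1 : ∀ δ, k δ ≤ 1 := fun δ => min_le_left _ _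
  have hkc : Continuous k := continuous_const.min
    (continuous_const.div (continuous_norm.comp continuous_subtype_val) fun δ => (hnorm δ).ne')
  have hscale : ∀ (δ : D) (κ : ℝ), 0 < κ → κ ≤ 1 → (δ : ℂ) * κ ∈ D := by
    intro δ κ h0 h1
    refine ⟨?_, mul_ne_zero δ.2.2 (Complex.ofReal_ne_zero.2 h0.ne')⟩
    have h2 := δ.2.1
    rw [mem_ball_zero_iff] at h2 ⊢
    rw [norm_mul, Complex.norm_real, Real.norm_of_nonneg h0.le]
    exact (mul_le_of_le_one_right (norm_nonneg _) h1).trans_lt h2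
  have hkball : ∀ δ : D, (δ : ℂ) * k δ ∈ Metric.ball (0 : ℂ) ρ := by
    intro δ
    rw [mem_ball_zero_iff, norm_mul, Complex.norm_real, Real.norm_of_nonneg (hk0 δ).le]
    calc ‖(δ : ℂ)‖ * k δ ≤ ‖(δ : ℂ)‖ * (ε / ‖(δ : ℂ)‖) :=
          mul_le_mul_of_nonneg_left (min_le_right _ _) (norm_nonneg _)
      _ = ε := mul_div_cancel₀ _ (hnorm δ).ne'
      _ < ρ := half_lt_self hρ
  have hκ : ∀ (t : I) (δ : D), 0 < (1 - (t : ℝ)) * k δ + t ∧ (1 - (t : ℝ)) * k δ + t ≤ 1 := by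
    intro t δ
    have h1 := t.2.1
    have h2 := t.2.2
    have h3 := hk0 δ
    have h4 := hk1 δ
    constructor
    · rcases h1.eq_or_lt with h | h
      · rw [← h]; simpa using h3
      · have := mul_nonneg (sub_nonneg.2 h2) h3.le
        linarith
    · nlinarith
  have cov := (isCoveringMapOn_fixMap p hq hs).isCoveringMap_restrictPreimage
  let H : C(I × D, (D ×ˢ ({0} : Set ℂ) : Set (ℂ × ℂ))) :=
    ⟨fun x => ⟨((x.2 : ℂ) * (((1 - (x.1 : ℝ)) * k x.2 + x.1 : ℝ) : ℂ), 0),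
      hscale x.2 _ (hκ x.1 x.2).1 (hκ x.1 x.2).2, rfl⟩, by
      refine Continuous.subtype_mk (Continuous.prodMk ?_ continuous_const) _
      have : Continuous fun x : I × D => k x.2 := hkc.comp continuous_snd
      fun_prop⟩
  let f : C(D, fixMap p q ⁻¹' (D ×ˢ ({0} : Set ℂ))) :=
    ⟨fun δ => ⟨((δ : ℂ) * k δ, χ₀ ((δ : ℂ) * k δ)), hscale δ _ (hk0 δ) (hk1 δ),
      (hρb _ (hkball δ)).2⟩, by
      have h1 : Continuous fun δ : D => (δ : ℂ) * k δ :=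
        continuous_subtype_val.mul (Complex.continuous_ofReal.comp hkc)
      refine Continuous.subtype_mk (h1.prodMk ?_) _
      refine continuous_iff_continuousAt.2 fun δ => ?_
      exact ContinuousAt.comp (g := χ₀) (hρb _ (hkball δ)).1.continuousAt h1.continuousAt⟩
  have hH0 : ∀ δ, H (0, δ) = (D ×ˢ ({0} : Set ℂ)).restrictPreimage (fixMap p q) (f δ) := by
    intro δ
    refine Subtype.ext (Prod.ext ?_ ?_)
    · simp [H, f, fixMap]
    · exact (hρb _ (hkball δ)).2.symm
  set Λ := cov.liftHomotopy H f hH0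
  have hΛ : ∀ t δ, fixMap p q (Λ (t, δ)) = H (t, δ) := fun t δ =>
    congrArg Subtype.val (congrFun (cov.liftHomotopy_lifts H f hH0) (t, δ))
  have hΛ1 : ∀ δ, ((Λ (1, δ) : ℂ × ℂ).1 = δ) ∧ fixFun p q (Λ (1, δ)) = 0 := by
    intro δ
    obtain ⟨h1, h2⟩ := Prod.ext_iff.1 (hΛ 1 δ)
    exact ⟨h1.trans (by simp [H]), h2⟩
  set χ : ℂ → ℂ := fun δ => if h : δ ∈ D then (Λ (1, ⟨δ, h⟩) : ℂ × ℂ).2 else χ₀ 0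
  have hχD : ∀ δ : D, χ δ = (Λ (1, δ) : ℂ × ℂ).2 := fun δ => dif_pos δ.2
  have hχfix : ∀ δ ∈ D, fixFun p q (δ, χ δ) = 0 := by
    intro δ hδ
    obtain ⟨h1, h2⟩ := hΛ1 ⟨δ, hδ⟩
    have h3 : (δ, χ δ) = (Λ (1, ⟨δ, hδ⟩) : ℂ × ℂ) := Prod.ext h1.symm (hχD ⟨δ, hδ⟩)
    rw [h3, h2]
  have hχc : ContinuousOn χ D := by
    rw [continuousOn_iff_continuous_domRestrict]
    have : D.domRestrict χ = fun δ : D => (Λ (1, δ) : ℂ × ℂ).2 := funext hχD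
    rw [this]
    exact continuous_snd.comp (continuous_subtype_val.comp
      (Λ.continuous.comp (continuous_const.prodMk continuous_id)))
  have hχ0 : χ =ᶠ[𝓝 0] χ₀ := by
    filter_upwards [Metric.ball_mem_nhds (0 : ℂ) hε, Metric.ball_mem_nhds (0 : ℂ) hr] with δ h1 h2
    rcases eq_or_ne δ 0 with rfl | hne
    · exact dif_neg fun h => h.2 rfl
    · have hδ : δ ∈ D := ⟨h2, hne⟩
      have hkδ : k ⟨δ, hδ⟩ = 1 := by
        refine min_eq_left ?_
        rw [one_le_div (norm_pos_iff.2 hne)]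
        exact (mem_ball_zero_iff.1 h1).le
      -- The path that is lifted is constant, hence so is its lift.
      have hconst : Λ (1, ⟨δ, hδ⟩) = Λ (0, ⟨δ, hδ⟩) := by
        refine cov.const_of_comp (g := fun t : I => Λ (t, ⟨δ, hδ⟩))
          (Λ.continuous.comp (continuous_id.prodMk continuous_const)) (fun t t' => ?_) 1 0
        refine Subtype.ext ?_
        change fixMap p q (Λ (t, ⟨δ, hδ⟩)) = fixMap p q (Λ (t', ⟨δ, hδ⟩))
        rw [hΛ, hΛ]
        simp [H, hkδ]
      rw [hχD ⟨δ, hδ⟩, hconst, cov.liftHomotopy_zero]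
      simp [f, hkδ]
  refine ⟨χ, fun δ hδ => ?_, hχ0, fun δ hδ => ?_⟩
  · rcases eq_or_ne δ 0 with rfl | hne
    · exact han.congr hχ0.symm
    · have hδD : δ ∈ D := ⟨hδ, hne⟩
      refine analyticAt_of_implicit (contDiff_fixFun p q).contDiffAt (hasDerivAt_fixFun p q δ _)
        (sub_ne_zero.2 (hs δ hδD _ (hχfix δ hδD))) (hχc.continuousAt (hDo.mem_nhds hδD)) ?_
      filter_upwards [hDo.mem_nhds hδD] with w hw using hχfix w hw
  · rcases eq_or_ne δ 0 with rfl | hne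
    · rw [hχ0.self_of_nhds]
      exact hfix.self_of_nhds
    · exact hχfix δ ⟨hδ, hne⟩

/-- Two analytic branches of fixed points over the disc that agree at one nonzero parameter are
equal, because the fixed points there are simple. -/
theorem branch_unique {p : ℤ} {q : ℕ} {r : ℝ}
    (hs : ∀ δ ∈ Metric.ball (0 : ℂ) r \ {0}, ∀ z, fixFun p q (δ, z) = 0 →
      deriv (quadP ((p : ℂ) / q + δ ^ q))^[q] z ≠ 1) {u v : ℂ → ℂ}
    (hu : AnalyticOnNhd ℂ u (Metric.ball 0 r)) (hv : AnalyticOnNhd ℂ v (Metric.ball 0 r))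
    (hfu : ∀ δ ∈ Metric.ball (0 : ℂ) r, fixFun p q (δ, u δ) = 0)
    (hfv : ∀ δ ∈ Metric.ball (0 : ℂ) r, fixFun p q (δ, v δ) = 0)
    {δ : ℂ} (hδ : δ ∈ Metric.ball (0 : ℂ) r \ {0}) (h : u δ = v δ) :
    Set.EqOn u v (Metric.ball 0 r) := by
  refine hu.eqOn_of_preconnected_of_eventuallyEq hv (convex_ball 0 r).isPreconnected hδ.1 ?_
  have hn := Metric.isOpen_ball.mem_nhds hδ.1
  exact eventually_eq_of_implicit (contDiff_fixFun p q).contDiffAt (hasDerivAt_fixFun p q δ (u δ))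
    (sub_ne_zero.2 (hs δ hδ _ (hfu δ hδ.1))) (hfu δ hδ.1) (hu δ hδ.1).continuousAt
    (hv δ hδ.1).continuousAt rfl h.symm (by filter_upwards [hn] with w hw using hfu w hw)
    (by filter_upwards [hn] with w hw using hfv w hw)

/-! ### The cycle -/

theorem mainTheorem9 (p : ℤ) (q : ℕ) (hq : 0 < q) (hpq : IsCoprime p (q : ℤ))
    (ζ : ℂ) (hζ : ζ = Complex.exp (2 * Complex.I * Real.pi * ((p : ℂ) / (q : ℂ)))) :
    0 < smallR p q ∧
    ∃ χ : ℂ → ℂ, AnalyticOnNhd ℂ χ (Metric.ball 0 (smallR p q)) ∧ χ 0 = 0 ∧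
      ∀ δ ∈ Metric.ball (0 : ℂ) (smallR p q) \ {0},
        χ δ ≠ 0 ∧
        IsCycle (quadP ((p : ℂ) / (q : ℂ) + δ ^ q)) q {w | ∃ k < q, w = χ (ζ ^ k * δ)} ∧
        quadP ((p : ℂ) / (q : ℂ) + δ ^ q) (χ δ) = χ (ζ * δ) := by
  have hR := bigR_pos (p := p) hq
  have hr : 0 < smallR p q := Real.rpow_pos_of_pos hR _
  refine ⟨hr, ?_⟩
  set r := smallR p q
  have hrR : r ^ q = bigR p q := by
    simp only [r, smallR, one_div]
    exact Real.rpow_inv_natCast_pow hR.le hq.ne'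
  have hζ' : ζ = Complex.exp (2 * Real.pi * Complex.I * ((p : ℂ) / q)) := by
    rw [hζ]; congr 1; ring
  have hprim : IsPrimitiveRoot ζ q := by
    rw [hζ']
    exact Complex.isPrimitiveRoot_exp_of_isCoprime p q hq.ne' hpq
  have hζn : ‖ζ‖ = 1 := Complex.norm_eq_one_of_pow_eq_one hprim.pow_eq_one hq.ne'
  have hs : ∀ δ ∈ Metric.ball (0 : ℂ) r \ {0}, ∀ z, fixFun p q (δ, z) = 0 →
      deriv (quadP ((p : ℂ) / q + δ ^ q))^[q] z ≠ 1 := by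
    intro δ hδ z hz hd
    have hδ1 : ‖δ‖ < r := mem_ball_zero_iff.1 hδ.1
    refine (isGreatest_bigR (p := p) hq).1 ((p : ℂ) / q + δ ^ q) ⟨?_, ?_⟩ z ⟨sub_eq_zero.1 hz, hd⟩
    · rw [Metric.mem_ball, dist_eq_norm, add_sub_cancel_left, norm_pow, ← hrR]
      exact pow_lt_pow_left₀ hδ1 (norm_nonneg _) hq.ne'
    · intro h
      exact pow_ne_zero q hδ.2 (add_eq_left.1 h)
  obtain ⟨χ₀, h₀an, h₀0, h₀d, h₀fix, h₀map⟩ := exists_local_branch hq hpq hζ'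
  obtain ⟨χ, hχ, hχ₀, hfix⟩ := exists_continuation_of_branch p hq hr hs h₀an h₀fix
  have hχ0 : χ 0 = 0 := by rw [hχ₀.self_of_nhds, h₀0]
  have hχd : deriv χ 0 ≠ 0 := by rwa [hχ₀.deriv_eq]
  have h0mem : (0 : ℂ) ∈ Metric.ball (0 : ℂ) r := Metric.mem_ball_self hr
  have hmul : ∀ ξ : ℂ, ‖ξ‖ = 1 → Set.MapsTo (fun δ => ξ * δ) (Metric.ball (0 : ℂ) r)
      (Metric.ball 0 r) := by
    intro ξ hξ δ hδ
    rw [mem_ball_zero_iff] at hδ ⊢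
    rwa [norm_mul, hξ, one_mul]
  have hmulan : ∀ ξ : ℂ, ‖ξ‖ = 1 → AnalyticOnNhd ℂ (fun δ => χ (ξ * δ)) (Metric.ball 0 r) :=
    fun ξ hξ => hχ.comp (fun δ _ => analyticAt_const.mul analyticAt_id) (hmul ξ hξ)
  -- The conjugacy relation propagates from the centre by the identity theorem.
  have hmap : ∀ δ ∈ Metric.ball (0 : ℂ) r,
      quadP ((p : ℂ) / q + δ ^ q) (χ δ) = χ (ζ * δ) := by
    have hexp : AnalyticOnNhd ℂ (fun δ : ℂ => Complex.exp (2 * Real.pi * Complex.I *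
        ((p : ℂ) / q + δ ^ q))) (Metric.ball 0 r) := by
      have : Differentiable ℂ (fun δ : ℂ => Complex.exp (2 * Real.pi * Complex.I *
        ((p : ℂ) / q + δ ^ q))) := by fun_prop
      exact fun δ _ => this.analyticAt δ
    have hlhs : AnalyticOnNhd ℂ (fun δ => quadP ((p : ℂ) / q + δ ^ q) (χ δ)) (Metric.ball 0 r) :=
      (hexp.mul hχ).add (hχ.pow 2)
    refine hlhs.eqOn_of_preconnected_of_eventuallyEq (hmulan ζ hζn)
      (convex_ball 0 r).isPreconnected h0mem ?_
    have ht : Tendsto (fun δ => ζ * δ) (𝓝 0) (𝓝 0) := by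
      have : ContinuousAt (fun δ : ℂ => ζ * δ) 0 := by fun_prop
      simpa using this.tendsto
    filter_upwards [h₀map, hχ₀, ht.eventually hχ₀] with δ h1 h2 h3
    rw [h2, h3, h1]
  have hiter : ∀ (k : ℕ), ∀ δ ∈ Metric.ball (0 : ℂ) r,
      (quadP ((p : ℂ) / q + δ ^ q))^[k] (χ δ) = χ (ζ ^ k * δ) := by
    intro k δ hδ
    induction k with
    | zero => simp
    | succ k ih =>
      have hk : (ζ ^ k * δ) ^ q = δ ^ q := by
        rw [mul_pow, ← pow_mul, mul_comm k, pow_mul, hprim.pow_eq_one, one_pow, one_mul]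
      have h1 := hmap (ζ ^ k * δ) (hmul (ζ ^ k) (by rw [norm_pow, hζn, one_pow]) hδ)
      rw [hk] at h1
      rw [Function.iterate_succ_apply', ih, h1, ← mul_assoc, pow_succ']
  refine ⟨χ, hχ, hχ0, fun δ hδ => ⟨fun h => ?_, ⟨hq, χ δ, ?_, ?_⟩, hmap δ hδ.1⟩⟩
  · -- Otherwise `χ` would be the branch of the fixed point `0`.
    have h1 : Set.EqOn χ (fun _ => 0) (Metric.ball 0 r) := by
      refine branch_unique hs hχ analyticOnNhd_const hfix (fun w _ => ?_) hδ h
      have : quadP ((p : ℂ) / q + w ^ q) 0 = 0 := by simp [quadP]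
      rw [fixFun, Function.iterate_fixed this, sub_self]
    exact hχd ((h1.eventuallyEq_of_mem (Metric.ball_mem_nhds 0 hr)).deriv_eq.trans
      (deriv_const 0 0))
  · have hper : Function.IsPeriodicPt (quadP ((p : ℂ) / q + δ ^ q)) q (χ δ) :=
      sub_eq_zero.1 (hfix δ hδ.1)
    refine le_antisymm (hper.minimalPeriod_le hq) ?_
    by_contra! hlt
    set k := Function.minimalPeriod (quadP ((p : ℂ) / q + δ ^ q)) (χ δ)
    have hk0 : 0 < k := hper.minimalPeriod_pos hq
    have hζk : ‖ζ ^ k‖ = 1 := by rw [norm_pow, hζn, one_pow]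
    -- A shorter period would identify the branches `χ` and `χ (ζ ^ k ·)`, but these have
    -- different derivatives at `0`.
    have h1 : Set.EqOn (fun w => χ (ζ ^ k * w)) χ (Metric.ball 0 r) := by
      refine branch_unique hs (hmulan _ hζk) hχ (fun w hw => ?_) hfix hδ ?_
      · have h2 := hfix _ (hmul _ hζk hw)
        have hk : (ζ ^ k * w) ^ q = w ^ q := by
          rw [mul_pow, ← pow_mul, mul_comm k, pow_mul, hprim.pow_eq_one, one_pow, one_mul]
        simpa only [fixFun, hk] using h2
      · exact (hiter k δ hδ.1).symm.trans (Function.iterate_minimalPeriod)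
    have h2 : deriv (fun w => χ (ζ ^ k * w)) 0 = deriv χ 0 :=
      (h1.eventuallyEq_of_mem (Metric.ball_mem_nhds 0 hr)).deriv_eq
    rw [deriv_comp_mul_left, mul_zero, smul_eq_mul] at h2
    exact hprim.pow_ne_one_of_pos_of_lt hk0.ne' hlt
      (mul_right_cancel₀ hχd (h2.trans (one_mul _).symm))
  · ext w
    exact exists_congr fun k => and_congr_right fun _ => by rw [hiter k δ hδ.1]
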